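/- Let $d\in\mathbb N$, $0<p\le\infty$ and $r=(r_1,\dots,r_d)$ with positive integers $r_i$. For a box $Q=[a_1,b_1]\times\cdots\times[a_d,b_d]\subset\mathbb R^d$ with $a_i \le b_i$, put $\delta=\delta(Q)=(b_1-a_1,\dots,b_d-a_d)$, and let $L_p(D)$, for a measurable set $D\subset\mathbb R^d$, be the space of real functions $f$ with finite (quasi-)norm $\|f\|_{p,D}=(\int_D|f|^p\,dx)^{1/p}$ (the essential supremum if $p=\infty$). Let $$E_r(f)_{p,Q}=\inf_{\varphi}\|f-\varphi\|_{p,Q},$$ where $\varphi$ runs over all real polynomials in $x_1,\dots,x_d$ of degree at most $r_i-1$ in the variable $x_i$, $i=1,\dots,d$. For $k\in\mathbb Z_+^d$ and $h\in\mathbb R^d$ let $\Delta_h^k=\prod_{i=1}^d\Delta_{h_i}^{k_i}$, where $\Delta_{h_i}^{k_i}$ is the univariate difference operator $\Delta_s^m(g,u)=\sum_{j=0}^m(-1)^{m-j}\binom mj g(u+js)$, with $m=k_i$ and $s=h_i$, applied in the variable $x_i$ with the other variables held fixed. Let $Q_{kh}$ be the set of all $x\in Q$ with $x_i+k_ih_i\in[a_i,b_i]$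 for every $i$. Define, for $t\in\mathbb R_+^d$, $$\omega_k(f,t)_{p,Q}=\sup_{|h_i|\le t_i,\ i=1,\dots,d}\|\Delta_h^k(f)\|_{p,Q_{kh}},\qquad \Omega_r(f,t)_{p,Q}=\sum_{\varnothing\ne e\subset\{1,\dots,d\}}\omega_{r(e)}(f,t)_{p,Q},$$ where $r(e)_i=r_i$ for $i\in e$ and $r(e)_i=0$ for $i\notin e$. Then there are constants $C,C'>0$ depending only on $r$, $d$ and $p$ such that, for every such box $Q$ and every $f\in L_p(Q)$, $$C'\,\Omega_r(f,\delta)_{p,Q}\le E_r(f)_{p,Q}\le C\,\Omega_r(f,\delta)_{p,Q}.$$ -/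

import Mathlib

open MeasureTheory
open scoped ENNReal NNReal

noncomputable section

namespace MixedWhitney

variable {d : ℕ}

/-- The univariate difference of order `k` and step `s`, applied to `f` in the variable `x i`
with the other variables held fixed. -/
def coordDiff (i : Fin d) (k : ℕ) (s : ℝ) (f : (Fin d → ℝ) → ℝ) : (Fin d → ℝ) → ℝ :=
  fun x => ∑ j ∈ Finset.range (k + 1),
    (-1 : ℝ) ^ (k - j) * (k.choose j : ℝ) * f (Function.update x i (x i + (j : ℝ) * s))

/-- The mixed difference operator of order `r` and step `h`: the composition over all coordinates
`i` of the univariate differences of order `r i` and step `h i` (these operators commute). -/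
def mixedDiff (r : Fin d → ℕ) (h : Fin d → ℝ) (f : (Fin d → ℝ) → ℝ) : (Fin d → ℝ) → ℝ :=
  (List.finRange d).foldr (fun i g => coordDiff i (r i) (h i) g) f

/-- For the box `Q = [a, b]`, the set `Q_y` of the points `x` of `Q` with
`x i, x i + y i ∈ [a i, b i]` for all `i`. -/
def shiftBox (a b y : Fin d → ℝ) : Set (Fin d → ℝ) :=
  {x | x ∈ Set.Icc a b ∧ ∀ i, x i ∈ Set.Icc (a i) (b i) ∧ x i + y i ∈ Set.Icc (a i) (b i)}

/-- The mixed modulus of smoothness of order `r` of `f` in `L_p` of the box `[a, b]`. -/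
def mixedModulus (r : Fin d → ℕ) (f : (Fin d → ℝ) → ℝ) (t : Fin d → ℝ) (p : ℝ≥0∞)
    (a b : Fin d → ℝ) : ℝ≥0∞ :=
  ⨆ (h : Fin d → ℝ) (_ : ∀ i, |h i| ≤ t i),
    eLpNorm (mixedDiff r h f) p (volume.restrict (shiftBox a b (fun i => (r i : ℝ) * h i)))

/-- The multi-index `r(e)`: equal to `r i` for `i ∈ e` and to `0` otherwise. -/
def restrictIndex (r : Fin d → ℕ) (e : Finset (Fin d)) : Fin d → ℕ :=
  fun i => if i ∈ e then r i else 0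

/-- The total mixed modulus of smoothness of order `r`. -/
def totalMixedModulus (r : Fin d → ℕ) (f : (Fin d → ℝ) → ℝ) (t : Fin d → ℝ) (p : ℝ≥0∞)
    (a b : Fin d → ℝ) : ℝ≥0∞ :=
  ∑ e : Finset (Fin d) with e.Nonempty, mixedModulus (restrictIndex r e) f t p a b

/-- The real polynomials of degree at most `r i - 1` in the variable `x i`, for all `i`
(for positive `r i`). -/
def polySet (r : Fin d → ℕ) : Set (MvPolynomial (Fin d) ℝ) :=
  {P | ∀ i, P.degreeOf i < r i}

/-- The error of best approximation of `f` by the polynomials of `polySet r` in `L_p` of the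
box `[a, b]`. -/
def bestApproxError (r : Fin d → ℕ) (f : (Fin d → ℝ) → ℝ) (p : ℝ≥0∞) (a b : Fin d → ℝ) :
    ℝ≥0∞ :=
  ⨅ P ∈ polySet r, eLpNorm (fun x => f x - MvPolynomial.eval x P) p
    (volume.restrict (Set.Icc a b))

end MixedWhitney

end

/-! The lower estimate is soft. A polynomial of degree below `r i` in `x i` is annihilated by every
mixed difference that has order `r i` in `x i`, because the differences in other variables keep it a
polynomial in `x i`. A difference is a finite combination of shifts, hence bounded on L_p. So the
difference of `f` equals that of `f - P` and is at most a constant times ‖f - P‖.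

The upper estimate uses only the moduli with e a singleton. Its core is
`exists_eLpNorm_sub_interp_le`, in one variable `x i`: for each ε, some Lagrange interpolant of `f`
at r equally spaced nodes has error at most ε‖f‖ + C(ε) M, where M bounds the r-th differences in `x
i`. On a fine grid of step h, a sequence with small r-th differences is close to a polynomial
(`exists_polynomial_near_seq`), so its terms are recovered by interpolation from every n-th term.
Moving `x i` to a nearby grid point costs an increment of `f`; the same discrete argument bounds it
by (K/n)‖f‖ + C_n M (`exists_eLpNorm_cutIncrement_le`). Point values are controlled by averaging
over the origin y of the grid: each error term is a function composed with a map whose push-forward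
measure is dominated by a fixed measure, and a good y is selected at the end. Only the
quasi-triangle inequality is used, so all 0 < p ≤ ∞ are covered at once.

The term ε‖f‖ is then absorbed. Subtracting φ of degree below r in `x i` leaves the r-th differences
unchanged; applying the core to f - φ with ε = 1/2 and taking the infimum over φ gives E ≤ E/2 + CM,
so E ≤ 2CM as E is finite. Interpolation in `x i` keeps a function polynomial in the other
variables, so the variables are treated one at a time (`exists_partialError_insert_le`). Finally, a
function polynomial in each variable separately is a polynomial (`exists_mvPolynomial_of_isPolyIn`).
-/

namespace MixedWhitney

/-! ### Quasi-norm inequalities, changes of variables and slices in L_p -/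

section Norms

variable {α β : Type*} [MeasurableSpace α] [MeasurableSpace β]

theorem one_le_LpAddConst (p : ℝ≥0∞) : 1 ≤ ENNReal.LpAddConst p := by
  unfold ENNReal.LpAddConst
  split_ifs with h
  · refine ENNReal.one_le_rpow (by norm_num) ?_
    have h1 : (1 : ℝ) < p.toReal⁻¹ := by
      have h2 : 0 < p.toReal := ENNReal.toReal_pos h.1.ne' (h.2.trans ENNReal.one_lt_top).ne
      have h3 : p.toReal < 1 := by
        simpa using (ENNReal.toReal_lt_toReal (h.2.trans ENNReal.one_lt_top).ne
          ENNReal.one_ne_top).2 h.2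
      exact (one_lt_inv₀ h2).2 h3
    rw [one_div]
    linarith
  · exact le_rfl

theorem eLpNorm_finset_sum_le_LpAddConst {ι : Type*} (p : ℝ≥0∞) (μ : Measure α) (s : Finset ι)
    (F : ι → α → ℝ) (hF : ∀ j ∈ s, AEStronglyMeasurable (F j) μ) :
    eLpNorm (fun x => ∑ j ∈ s, F j x) p μ ≤
      ENNReal.LpAddConst p ^ s.card * ∑ j ∈ s, eLpNorm (F j) p μ := by
  classical
  induction s using Finset.induction_on with
  | empty => simp
  | insert j s hj ih =>
    have hs : ∀ k ∈ s, AEStronglyMeasurable (F k) μ :=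
      fun k hk => hF k (Finset.mem_insert_of_mem hk)
    have hsum : AEStronglyMeasurable (fun x => ∑ k ∈ s, F k x) μ :=
      Finset.aestronglyMeasurable_fun_sum s hs
    simp only [Finset.sum_insert hj, Finset.card_insert_of_notMem hj]
    calc eLpNorm (fun x => F j x + ∑ k ∈ s, F k x) p μ
        ≤ ENNReal.LpAddConst p * (eLpNorm (F j) p μ + eLpNorm (fun x => ∑ k ∈ s, F k x) p μ) :=
          eLpNorm_add_le' (hF j (Finset.mem_insert_self j s)) hsum p
      _ ≤ ENNReal.LpAddConst p * (ENNReal.LpAddConst p ^ s.card * eLpNorm (F j) p μ +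
            ENNReal.LpAddConst p ^ s.card * ∑ k ∈ s, eLpNorm (F k) p μ) := by
          gcongr
          · exact le_mul_of_one_le_left (zero_le) (one_le_pow₀ (one_le_LpAddConst p))
          · exact ih hs
      _ = _ := by rw [pow_succ]; ring

/-- A constant for the quasi-triangle inequality with `n` summands. -/
noncomputable def sumConst (p : ℝ≥0∞) (n : ℕ) : ℝ≥0∞ := ENNReal.LpAddConst p ^ n * n

theorem sumConst_ne_top (p : ℝ≥0∞) (n : ℕ) : sumConst p n ≠ ∞ :=
  ENNReal.mul_ne_top (ENNReal.pow_ne_top (ENNReal.LpAddConst_lt_top p).ne) (ENNReal.natCast_ne_top n)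

theorem eLpNorm_le_of_abs_le_sum {ι : Type*} {p : ℝ≥0∞} {μ : Measure α} (s : Finset ι)
    {F : α → ℝ} {G : ι → α → ℝ} {c : ℝ} {B : ℝ≥0∞} (hc : 0 ≤ c)
    (hG : ∀ j ∈ s, AEStronglyMeasurable (G j) μ)
    (hFG : ∀ᵐ x ∂μ, |F x| ≤ c * ∑ j ∈ s, |G j x|)
    (hB : ∀ j ∈ s, eLpNorm (G j) p μ ≤ B) :
    eLpNorm F p μ ≤ ENNReal.ofReal c * sumConst p s.card * B := by
  have h1 : eLpNorm F p μ ≤ eLpNorm (fun x => c * ∑ j ∈ s, |G j x|) p μ :=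
    eLpNorm_mono_ae_real (by simpa only [Real.norm_eq_abs] using hFG)
  have h2 : eLpNorm (fun x => c * ∑ j ∈ s, |G j x|) p μ =
      ENNReal.ofReal c * eLpNorm (fun x => ∑ j ∈ s, |G j x|) p μ := by
    have := eLpNorm_const_smul (c := c) (f := fun x => ∑ j ∈ s, |G j x|) (p := p) (μ := μ)
    rw [Real.enorm_of_nonneg hc] at this
    exact this
  have h3 := eLpNorm_finset_sum_le_LpAddConst p μ s (fun j x => |G j x|)
    (fun j hj => by simpa using (hG j hj).norm)
  have h4 : ∑ j ∈ s, eLpNorm (fun x => |G j x|) p μ ≤ s.card * B := by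
    calc _ ≤ ∑ j ∈ s, B := Finset.sum_le_sum fun j hj => by
            have : eLpNorm (fun x => |G j x|) p μ = eLpNorm (G j) p μ := eLpNorm_norm (G j)
            rw [this]; exact hB j hj
      _ = _ := by simp
  calc eLpNorm F p μ ≤ ENNReal.ofReal c * (ENNReal.LpAddConst p ^ s.card * (s.card * B)) := by
        rw [h2] at h1
        refine h1.trans ?_
        gcongr
        exact h3.trans (by gcongr)
    _ = _ := by rw [sumConst]; ring

/-- Domination of the push-forward replaces an exact change of variables. For p = ∞ the exponent is
0 and only the null sets matter. -/
theorem eLpNorm_comp_le_of_map_le {p : ℝ≥0∞} {μ : Measure α} {ν : Measure β} {c : ℝ≥0∞}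
    (hc : c ≠ 0) {T : α → β} (hT : AEMeasurable T μ) (h : Measure.map T μ ≤ c • ν) {F : β → ℝ}
    (hF : Measurable F) :
    eLpNorm (fun x => F (T x)) p μ ≤ c ^ (1 / p).toReal * eLpNorm F p ν := by
  have h1 : eLpNorm (F ∘ T) p μ = eLpNorm F p (Measure.map T μ) :=
    (eLpNorm_map_measure hF.aestronglyMeasurable hT).symm
  have h2 := eLpNorm_smul_measure_of_ne_zero hc F p ν
  calc eLpNorm (F ∘ T) p μ = eLpNorm F p (Measure.map T μ) := h1
    _ ≤ eLpNorm F p (c • ν) := eLpNorm_mono_measure F h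
    _ = _ := by rw [h2, smul_eq_mul]

/-- Some value of a function is at most its mean: for finite p this is applied to the p-th power of
the slice norms. For p = ∞ almost every slice will do. -/
theorem exists_eLpNorm_slice_le {p : ℝ≥0∞} (hp : p ≠ 0) {μ : Measure β} [SFinite μ]
    {ν : Measure α} [IsProbabilityMeasure ν] {F : α × β → ℝ} (hF : Measurable F) :
    ∃ y, eLpNorm (fun x => F (y, x)) p μ ≤ eLpNorm F p (ν.prod μ) := by
  by_cases hp' : p = ∞
  · subst hp'
    have h1 : ∀ᵐ z ∂(ν.prod μ), ‖F z‖ₑ ≤ eLpNormEssSup F (ν.prod μ) := ae_le_eLpNormEssSup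
    obtain ⟨y, hy⟩ := (Measure.ae_ae_of_ae_prod h1).exists
    refine ⟨y, ?_⟩
    rw [eLpNorm_exponent_top, eLpNorm_exponent_top]
    exact essSup_le_of_ae_le _ hy
  · have hm : Measurable fun z => ‖F z‖ₑ ^ p.toReal := hF.enorm.pow_const _
    obtain ⟨y, hy⟩ := exists_le_lintegral (μ := ν)
      (f := fun y => ∫⁻ x, ‖F (y, x)‖ₑ ^ p.toReal ∂μ) hm.lintegral_prod_right'.aemeasurable
    refine ⟨y, ?_⟩
    rw [eLpNorm_eq_lintegral_rpow_enorm_toReal hp hp',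
      eLpNorm_eq_lintegral_rpow_enorm_toReal hp hp', lintegral_prod _ hm.aemeasurable]
    gcongr

theorem eLpNorm_prod_le_of_slice_le {p : ℝ≥0∞} (hp : p ≠ 0) {μ : Measure β} [SFinite μ]
    {ν : Measure α} [IsProbabilityMeasure ν] {F : α × β → ℝ} (hF : Measurable F) {B : ℝ≥0∞}
    (hB : ∀ᵐ y ∂ν, eLpNorm (fun x => F (y, x)) p μ ≤ B) :
    eLpNorm F p (ν.prod μ) ≤ B := by
  by_cases hp' : p = ∞
  · subst hp'
    rw [eLpNorm_exponent_top]
    refine essSup_le_of_ae_le _ ?_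
    have hs : MeasurableSet {z | ‖F z‖ₑ ≤ B} := measurableSet_le hF.enorm measurable_const
    refine (Measure.ae_prod_iff_ae_ae hs).2 ?_
    filter_upwards [hB] with y hy
    rw [eLpNorm_exponent_top] at hy
    filter_upwards [ae_le_eLpNormEssSup (f := fun x => F (y, x)) (μ := μ)] with x hx
    exact hx.trans hy
  · have hm : Measurable fun z => ‖F z‖ₑ ^ p.toReal := hF.enorm.pow_const _
    have hpos : 0 < p.toReal := ENNReal.toReal_pos hp hp'
    rw [eLpNorm_eq_lintegral_rpow_enorm_toReal hp hp', lintegral_prod _ hm.aemeasurable,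
      one_div, ENNReal.rpow_inv_le_iff hpos]
    calc _ ≤ ∫⁻ _, B ^ p.toReal ∂ν := by
          refine lintegral_mono_ae ?_
          filter_upwards [hB] with y hy
          rwa [eLpNorm_eq_lintegral_rpow_enorm_toReal hp hp', one_div,
            ENNReal.rpow_inv_le_iff hpos] at hy
      _ = _ := by simp

end Norms

/-! ### Measure-preserving substitutions in one coordinate -/

section Update

variable {d : ℕ}

theorem update_add_eq_add_single (i : Fin d) (c : ℝ) (x : Fin d → ℝ) :
    Function.update x i (x i + c) = x + Pi.single i c := by
  ext k
  by_cases h : k = i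
  · subst h; simp
  · simp [h]

theorem measurePreserving_update_add (i : Fin d) (c : ℝ) :
    MeasurePreserving (fun x : Fin d → ℝ => Function.update x i (x i + c)) volume volume := by
  simp only [update_add_eq_add_single]
  exact measurePreserving_add_right volume (Pi.single i c : Fin d → ℝ)

theorem measurable_update_prod (i : Fin d) (c : ℝ) :
    Measurable fun z : ℝ × (Fin d → ℝ) => Function.update z.2 i (z.1 + c) := by
  refine measurable_pi_lambda _ fun k => ?_
  by_cases h : k = i
  · subst h; simp only [Function.update_self]; fun_prop
  · simp only [Function.update_of_ne h]; fun_prop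

theorem measurePreserving_shear_fst (i : Fin d) :
    MeasurePreserving (fun z : ℝ × (Fin d → ℝ) => (z.1 + z.2 i, z.2))
      (volume.prod volume) (volume.prod volume) := by
  have h : MeasurePreserving (fun z : (Fin d → ℝ) × ℝ => (z.1, z.2 + z.1 i))
      (volume.prod volume) (volume.prod volume) :=
    (MeasurePreserving.id volume).skew_product
      (g := fun (x : Fin d → ℝ) (y : ℝ) => y + x i) (by fun_prop)
      (Filter.Eventually.of_forall fun x =>
        (measurePreserving_add_right (volume : Measure ℝ) (x i)).map_eq)
  exact (Measure.measurePreserving_swap.comp h).comp Measure.measurePreserving_swap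

theorem measurePreserving_shear_snd (i : Fin d) :
    MeasurePreserving (fun z : ℝ × (Fin d → ℝ) => (z.1, z.2 + Pi.single i (-z.1)))
      (volume.prod volume) (volume.prod volume) := by
  refine (MeasurePreserving.id volume).skew_product
    (g := fun (y : ℝ) (x : Fin d → ℝ) => x + Pi.single i (-y)) ?_
    (Filter.Eventually.of_forall fun y =>
      (measurePreserving_add_right volume (Pi.single i (-y) : Fin d → ℝ)).map_eq)
  refine measurable_pi_lambda _ fun k => ?_
  by_cases h : k = i
  · subst h; simp only [Pi.add_apply, Pi.single_eq_same, Function.uncurry]; fun_prop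
  · simp only [Pi.add_apply, Pi.single_eq_of_ne h, Function.uncurry]; fun_prop

/-- Exchanging a coordinate of a vector with an extra real variable preserves the volume. -/
theorem measurePreserving_exchange (i : Fin d) :
    MeasurePreserving (fun z : ℝ × (Fin d → ℝ) => (z.2 i, Function.update z.2 i z.1))
      (volume.prod volume) (volume.prod volume) := by
  have hneg : MeasurePreserving (fun z : ℝ × (Fin d → ℝ) => (-z.1, z.2))
      (volume.prod volume) (volume.prod volume) :=
    (Measure.measurePreserving_neg (volume : Measure ℝ)).prod (MeasurePreserving.id volume)
  -- The exchange is a reflection followed by three shears: (y, x i) ↦ (-y, x i) ↦ (x i - y, x i) ↦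
  -- (x i - y, y) ↦ (x i, y).
  have h := (measurePreserving_shear_fst i).comp
    ((measurePreserving_shear_snd i).comp ((measurePreserving_shear_fst i).comp hneg))
  convert h using 1
  ext z k
  · simp
  · by_cases hk : k = i
    · subst hk; simp
    · simp [hk]

/-- After a translation and the exchange of y with `x i`, the old coordinate `x i` is a free
variable in an interval of length `b i - a i`, which cancels the density 2 / (b i - a i) up to the
factor 2. -/
theorem map_update_prod_le {i : Fin d} {a b : Fin d → ℝ} (hab : a i < b i) (c : ℝ)
    {ν : Measure ℝ} [SFinite ν] (hν : ν ≤ ENNReal.ofReal (2 / (b i - a i)) • volume) :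
    Measure.map (fun z : ℝ × (Fin d → ℝ) => Function.update z.2 i (z.1 + c))
      (ν.prod (volume.restrict (Set.Icc a b))) ≤ (2 : ℝ≥0∞) • volume := by
  have hm := measurable_update_prod i c
  refine Measure.le_iff.2 fun A hA => ?_
  rw [Measure.map_apply hm hA]
  set T : ℝ × (Fin d → ℝ) → Fin d → ℝ := fun z => Function.update z.2 i (z.1 + c)
  have htr : MeasurePreserving (fun z : ℝ × (Fin d → ℝ) => (z.1 + c, z.2))
      (volume.prod volume) (volume.prod volume) :=
    (measurePreserving_add_right (volume : Measure ℝ) c).prod (MeasurePreserving.id volume)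
  have hmp := (measurePreserving_exchange i).comp htr
  have hle : ν.prod (volume.restrict (Set.Icc a b)) ≤
      ENNReal.ofReal (2 / (b i - a i)) •
        ((volume : Measure ℝ).prod (volume : Measure (Fin d → ℝ))).restrict
          (Set.univ ×ˢ Set.Icc a b) := by
    calc ν.prod (volume.restrict (Set.Icc a b))
        ≤ (ENNReal.ofReal (2 / (b i - a i)) • volume).prod (volume.restrict (Set.Icc a b)) :=
          Measure.prod_mono hν le_rfl
      _ = _ := by
          rw [Measure.prod_smul_left, ← Measure.prod_restrict, Measure.restrict_univ]
  have hpos : 0 < b i - a i := sub_pos.2 hab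
  calc ν.prod (volume.restrict (Set.Icc a b)) (T ⁻¹' A)
      ≤ ENNReal.ofReal (2 / (b i - a i)) *
        ((volume : Measure ℝ).prod (volume : Measure (Fin d → ℝ))).restrict
          (Set.univ ×ˢ Set.Icc a b) (T ⁻¹' A) := hle _
    _ ≤ ENNReal.ofReal (2 / (b i - a i)) *
        ((volume : Measure ℝ).prod (volume : Measure (Fin d → ℝ)))
          (Set.Icc (a i) (b i) ×ˢ A) := by
        refine mul_le_mul_right ?_ _
        rw [Measure.restrict_apply (hm hA), ← hmp.measure_preimage
          (measurableSet_Icc.prod hA).nullMeasurableSet]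
        refine measure_mono fun z hz => ?_
        have h1 := hz.2.2
        exact ⟨⟨h1.1 i, h1.2 i⟩, hz.1⟩
    _ = _ := by
        rw [Measure.prod_prod, Real.volume_Icc, ← mul_assoc, ← ENNReal.ofReal_mul (by positivity),
          div_mul_cancel₀ _ hpos.ne', Measure.smul_apply, smul_eq_mul]
        simp

theorem eLpNorm_update_prod_le {i : Fin d} {a b : Fin d → ℝ} (hab : a i < b i) (c : ℝ)
    {ν : Measure ℝ} [SFinite ν] (hν : ν ≤ ENNReal.ofReal (2 / (b i - a i)) • volume) (p : ℝ≥0∞)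
    {F : (Fin d → ℝ) → ℝ} (hF : Measurable F) :
    eLpNorm (fun z : ℝ × (Fin d → ℝ) => F (Function.update z.2 i (z.1 + c))) p
      (ν.prod (volume.restrict (Set.Icc a b))) ≤ 2 ^ (1 / p).toReal * eLpNorm F p volume :=
  eLpNorm_comp_le_of_map_le two_ne_zero (measurable_update_prod i c).aemeasurable
    (map_update_prod_le hab c hν) hF

end Update

/-! ### Sequences with small differences and discrete Lagrange interpolation -/

section Discrete

open Polynomial

theorem sum_diff_eval_eq_zero {r : ℕ} {P : ℝ[X]} (hP : P.degree < r) (x s : ℝ) :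
    ∑ j ∈ Finset.range (r + 1),
      (-1 : ℝ) ^ (r - j) * (r.choose j : ℝ) * P.eval (x + (j : ℝ) * s) = 0 := by
  by_cases hP0 : P = 0
  · simp [hP0]
  have hdeg : (P.comp (C x + C s * X)).natDegree < r := by
    have h1 : P.natDegree < r := (natDegree_lt_iff_degree_lt hP0).2 hP
    have h2 : (C x + C s * X).natDegree ≤ 1 := by
      refine (natDegree_add_le _ _).trans ?_
      simp only [natDegree_C, zero_le, sup_of_le_right]
      simpa using natDegree_C_mul_X_pow_le s 1
    calc (P.comp (C x + C s * X)).natDegree ≤ P.natDegree * (C x + C s * X).natDegree :=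
          natDegree_comp_le
      _ ≤ P.natDegree * 1 := by gcongr
      _ < r := by simpa using h1
  have h := congrFun (fwdDiff_iter_eq_zero_of_degree_lt hdeg) 0
  rw [fwdDiff_iter_eq_sum_shift] at h
  simp only [eval_comp, zsmul_eq_mul, eval_add, eval_mul, eval_C, eval_X, nsmul_eq_mul, mul_one,
    zero_add, Pi.zero_apply] at h
  rw [← h]
  refine Finset.sum_congr rfl fun j _ => ?_
  push_cast
  ring_nf

/-- The Lagrange basis polynomials for the nodes `0, …, r - 1`. -/
noncomputable def lagr (r j : ℕ) : ℝ[X] := Lagrange.basis (Finset.range r) (fun k : ℕ => (k : ℝ)) j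

theorem degree_lagr_lt {r j : ℕ} (hj : j < r) : (lagr r j).degree < r := by
  rw [lagr, Lagrange.degree_basis (Nat.cast_injective.injOn) (Finset.mem_range.2 hj),
    Finset.card_range]
  exact_mod_cast (by omega : r - 1 < r)

theorem eval_eq_sum_lagr {r : ℕ} {P : ℝ[X]} (hP : P.degree < r) (x : ℝ) :
    P.eval x = ∑ j ∈ Finset.range r, (lagr r j).eval x * P.eval (j : ℝ) := by
  have h := Lagrange.eq_interpolate (s := Finset.range r) (v := fun k : ℕ => (k : ℝ)) (f := P)
    (Nat.cast_injective.injOn) (by simpa using hP)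
  conv_lhs => rw [h]
  rw [Lagrange.interpolate_apply, eval_finsetSum]
  simp only [eval_mul, eval_C]
  exact Finset.sum_congr rfl fun j _ => mul_comm _ _

theorem exists_abs_eval_le (P : ℝ[X]) (R : ℝ) :
    ∃ L : ℝ, 0 ≤ L ∧ ∀ x, |x| ≤ R → |P.eval x| ≤ L := by
  obtain ⟨L, hL⟩ := (isCompact_Icc (a := -R) (b := R)).exists_bound_of_continuousOn
    (f := fun x => P.eval x) P.continuous.continuousOn
  exact ⟨max L 0, le_max_right _ _, fun x hx => (hL x (abs_le.1 hx)).trans (le_max_left _ _)⟩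

theorem exists_abs_eval_sub_le (P : ℝ[X]) (R : ℝ) :
    ∃ L : ℝ, 0 ≤ L ∧ ∀ x y, |x| ≤ R → |y| ≤ R → |P.eval x - P.eval y| ≤ L * |x - y| := by
  obtain ⟨L, hL0, hL⟩ := exists_abs_eval_le (derivative P) R
  refine ⟨L, hL0, fun x y hx hy => ?_⟩
  have := (convex_Icc (-R) R).norm_image_sub_le_of_norm_hasDerivWithin_le
    (f := fun x => P.eval x) (f' := fun x => (derivative P).eval x) (C := L)
    (fun z _ => (P.hasDerivAt z).hasDerivWithinAt) (fun z hz => hL z (abs_le.2 hz))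
    (abs_le.1 hy) (abs_le.1 hx)
  simpa [Real.norm_eq_abs] using this

theorem exists_lagr_bound (r : ℕ) (R : ℝ) :
    ∃ L : ℝ, 0 ≤ L ∧ (∀ j < r, ∀ x, |x| ≤ R → |(lagr r j).eval x| ≤ L) ∧
      ∀ j < r, ∀ x y, |x| ≤ R → |y| ≤ R →
        |(lagr r j).eval x - (lagr r j).eval y| ≤ L * |x - y| := by
  choose L1 h1 h1' using fun j => exists_abs_eval_le (lagr r j) R
  choose L2 h2 h2' using fun j => exists_abs_eval_sub_le (lagr r j) R
  refine ⟨∑ j ∈ Finset.range r, (L1 j + L2 j),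
    Finset.sum_nonneg fun j _ => add_nonneg (h1 j) (h2 j), fun j hj x hx => ?_,
    fun j hj x y hx hy => ?_⟩
  · have := Finset.single_le_sum (f := fun j => L1 j + L2 j)
      (fun j _ => add_nonneg (h1 j) (h2 j)) (Finset.mem_range.2 hj)
    have h3 := h1' j x hx
    have h4 := h2 j
    linarith
  · have := Finset.single_le_sum (f := fun j => L1 j + L2 j)
      (fun j _ => add_nonneg (h1 j) (h2 j)) (Finset.mem_range.2 hj)
    have h4 := h1 j
    refine (h2' j x y hx hy).trans ?_
    gcongr
    linarith

/-- The difference of order `r` of a sequence indexed by the integers. -/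
def seqDiff (r : ℕ) (s : ℤ → ℝ) (l : ℤ) : ℝ :=
  ∑ j ∈ Finset.range (r + 1), (-1 : ℝ) ^ (r - j) * (r.choose j : ℝ) * s (l + j)

/-- A discrete Whitney estimate. Interpolate the first r terms; the r-th difference of the error is
that of `s`, and it expresses each further error through the r preceding ones. This recursion
multiplies the bound by at most 1 + 2^r per step. -/
theorem exists_polynomial_near_seq (r : ℕ) (s : ℤ → ℝ) (lo hi : ℤ) {S : ℝ} (hS0 : 0 ≤ S)
    (hS : ∀ l, lo ≤ l → l + r ≤ hi → |seqDiff r s l| ≤ S) :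
    ∃ Q : ℝ[X], Q.degree < r ∧ ∀ k : ℕ, lo + k ≤ hi →
      |s (lo + k) - Q.eval ((lo : ℝ) + k)| ≤ (1 + 2 ^ r) ^ k * S := by
  have hinj : Set.InjOn (fun k : ℕ => (lo : ℝ) + k) (Finset.range r) :=
    fun k _ k' _ h => by simpa using h
  set Q := Lagrange.interpolate (Finset.range r) (fun k : ℕ => (lo : ℝ) + k)
    (fun k : ℕ => s (lo + k)) with hQ
  have hQd : Q.degree < r := by
    have h := Lagrange.degree_interpolate_lt (s := Finset.range r) (fun k : ℕ => s (lo + k)) hinj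
    rwa [Finset.card_range] at h
  refine ⟨Q, hQd, fun k => ?_⟩
  induction k using Nat.strong_induction_on with
  | _ k ih =>
    intro hk
    have hpos : (0 : ℝ) ≤ (1 + 2 ^ r) ^ k * S := by positivity
    by_cases hkr : k < r
    · rw [hQ, Lagrange.eval_interpolate_at_node (s := Finset.range r)
        (v := fun k : ℕ => (lo : ℝ) + k) (fun k : ℕ => s (lo + k)) hinj (Finset.mem_range.2 hkr)]
      simpa using hpos
    · obtain ⟨k', rfl⟩ : ∃ k', k = k' + r := ⟨k - r, by omega⟩
      have h0 := sum_diff_eval_eq_zero hQd ((lo : ℝ) + k') 1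
      have h1 : seqDiff r s (lo + k') = ∑ j ∈ Finset.range (r + 1),
          (-1 : ℝ) ^ (r - j) * (r.choose j : ℝ) *
            (s (lo + (k' + j : ℕ)) - Q.eval ((lo : ℝ) + (k' + j : ℕ))) := by
        rw [seqDiff, ← sub_zero (∑ j ∈ Finset.range (r + 1), _), ← h0, ← Finset.sum_sub_distrib]
        refine Finset.sum_congr rfl fun j _ => ?_
        push_cast
        rw [mul_one, add_assoc, add_assoc, mul_sub]
      rw [Finset.sum_range_succ] at h1
      simp only [Nat.sub_self, pow_zero, Nat.choose_self, Nat.cast_one, one_mul] at h1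
      -- The order 0 is separate because the exponent `k' + r - 1` used below would be truncated.
      rcases Nat.eq_zero_or_pos r with hr | hr
      · subst hr
        simp only [Finset.range_zero, Finset.sum_empty, zero_add] at h1
        rw [← h1]
        refine (hS _ (by omega) (by push_cast at hk ⊢; omega)).trans ?_
        exact le_mul_of_one_le_left hS0 (one_le_pow₀ (by norm_num))
      have h2 : |∑ j ∈ Finset.range r, (-1 : ℝ) ^ (r - j) * (r.choose j : ℝ) *
            (s (lo + (k' + j : ℕ)) - Q.eval ((lo : ℝ) + (k' + j : ℕ)))| ≤
          2 ^ r * ((1 + 2 ^ r) ^ (k' + r - 1) * S) := by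
        calc _ ≤ ∑ j ∈ Finset.range r, (r.choose j : ℝ) * ((1 + 2 ^ r) ^ (k' + r - 1) * S) := by
              refine (Finset.abs_sum_le_sum_abs _ _).trans (Finset.sum_le_sum fun j hj => ?_)
              have hj' := Finset.mem_range.1 hj
              rw [abs_mul, abs_mul, abs_pow, abs_neg, abs_one, one_pow, one_mul, Nat.abs_cast]
              gcongr
              refine (ih (k' + j) (by omega) (by push_cast at hk ⊢; omega)).trans ?_
              gcongr
              · exact le_add_of_nonneg_right (by positivity)
              · omega
          _ ≤ _ := by
              rw [← Finset.sum_mul]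
              gcongr
              have h3 := Nat.sum_range_choose r
              rw [Finset.sum_range_succ] at h3
              have h4 : ∑ j ∈ Finset.range r, r.choose j ≤ 2 ^ r := by omega
              exact_mod_cast h4
      have h5 := hS (lo + k') (by omega) (by push_cast at hk; omega)
      have h6 : s (lo + (k' + r : ℕ)) - Q.eval ((lo : ℝ) + (k' + r : ℕ)) = seqDiff r s (lo + k') -
          ∑ j ∈ Finset.range r, (-1 : ℝ) ^ (r - j) * (r.choose j : ℝ) *
            (s (lo + (k' + j : ℕ)) - Q.eval ((lo : ℝ) + (k' + j : ℕ))) := by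
        rw [h1]; ring
      rw [h6]
      refine (abs_sub _ _).trans ((add_le_add h5 h2).trans ?_)
      have h7 : (1 : ℝ) ≤ (1 + 2 ^ r) ^ (k' + r - 1) :=
        one_le_pow₀ (le_add_of_nonneg_right (by positivity))
      have h8 : ((1 : ℝ) + 2 ^ r) ^ (k' + r) = (1 + 2 ^ r) ^ (k' + r - 1) * (1 + 2 ^ r) := by
        rw [← pow_succ]; congr 1; omega
      rw [h8]
      nlinarith [mul_le_mul_of_nonneg_right h7 hS0]

/-- The polynomial close to `s` is reproduced exactly by interpolation at 0, n, …, (r - 1)n, so only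
the distances from `s` to it, at m and at the nodes, remain. The sum of all differences stands in
for their maximum, since a sum of functions is what the L_p quasi-norm handles. -/
theorem exists_seq_interp_bound {r n : ℕ} (hn : 0 < n) (N : ℕ) :
    ∃ A : ℝ, 0 ≤ A ∧ ∀ (s : ℤ → ℝ) (lo hi m : ℤ), lo ≤ 0 → lo ≤ m → m ≤ hi → 0 ≤ hi →
      (r - 1) * n ≤ hi → hi - lo ≤ N →
      |s m - ∑ j ∈ Finset.range r, (lagr r j).eval ((m : ℝ) / n) * s (j * n)| ≤
        A * ∑ l ∈ Finset.Icc lo (hi - r), |seqDiff r s l| := by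
  obtain ⟨L, hL0, hL, -⟩ := exists_lagr_bound r N
  set B : ℝ := (1 + 2 ^ r) ^ N
  have hB0 : 0 ≤ B := by positivity
  -- B accounts for the error at m; each of the r nodes adds an error B weighted by a Lagrange
  -- coefficient of size at most L.
  refine ⟨B + r * (L * B), by positivity, fun s lo hi m hlo hlom hmhi hhi hnode hN => ?_⟩
  set S : ℝ := ∑ l ∈ Finset.Icc lo (hi - r), |seqDiff r s l|
  have hS0 : 0 ≤ S := Finset.sum_nonneg fun _ _ => abs_nonneg _
  obtain ⟨Q, hQd, hQ⟩ := exists_polynomial_near_seq r s lo hi hS0 fun l h1 h2 =>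
    Finset.single_le_sum (f := fun l => |seqDiff r s l|) (fun _ _ => abs_nonneg _)
      (Finset.mem_Icc.2 ⟨h1, by omega⟩)
  have he : ∀ l : ℤ, lo ≤ l → l ≤ hi → |s l - Q.eval (l : ℝ)| ≤ B * S := by
    intro l h1 h2
    obtain ⟨k, rfl⟩ : ∃ k : ℕ, l = lo + k := ⟨(l - lo).toNat, by omega⟩
    refine le_trans (by simpa using hQ k h2) ?_
    gcongr
    exact pow_le_pow_right₀ (le_add_of_nonneg_right (by positivity)) (by omega)
  have hn' : (n : ℝ) ≠ 0 := by exact_mod_cast hn.ne'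
  -- Rescaling by n turns the nodes j n into the nodes j of `lagr`.
  have hcomp : Q.eval (m : ℝ) =
      ∑ j ∈ Finset.range r, (lagr r j).eval ((m : ℝ) / n) * Q.eval (((j * n : ℤ)) : ℝ) := by
    have hd : (Q.comp (C (n : ℝ) * X)).degree < r := by
      by_cases hQ0 : Q = 0
      · simp [hQ0]
      · refine lt_of_le_of_lt (degree_le_of_natDegree_le (natDegree_comp_le.trans ?_))
          (by rwa [degree_eq_natDegree hQ0] at hQd)
        rw [natDegree_C_mul_X _ hn', mul_one]
    have h := eval_eq_sum_lagr hd ((m : ℝ) / n)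
    simp only [eval_comp, eval_mul, eval_C, eval_X] at h
    rw [mul_div_cancel₀ _ hn'] at h
    rw [h]
    refine Finset.sum_congr rfl fun j _ => ?_
    push_cast
    rw [mul_comm (n : ℝ)]
  have hsplit : s m - ∑ j ∈ Finset.range r, (lagr r j).eval ((m : ℝ) / n) * s (j * n) =
      (s m - Q.eval (m : ℝ)) - ∑ j ∈ Finset.range r,
        (lagr r j).eval ((m : ℝ) / n) * (s (j * n) - Q.eval (((j * n : ℤ)) : ℝ)) := by
    simp only [mul_sub, Finset.sum_sub_distrib]
    rw [← hcomp]; ring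
  rw [hsplit, add_mul]
  refine (abs_sub _ _).trans (add_le_add (he m hlom hmhi) ?_)
  have hm : |(m : ℝ) / n| ≤ N := by
    rw [abs_div, Nat.abs_cast]
    have h1 : |(m : ℝ)| ≤ N := by
      have : |m| ≤ (N : ℤ) := by rw [abs_le]; constructor <;> omega
      exact_mod_cast this
    exact (div_le_self (abs_nonneg _) (by exact_mod_cast hn)).trans h1
  calc _ ≤ ∑ j ∈ Finset.range r, L * (B * S) := by
        refine (Finset.abs_sum_le_sum_abs _ _).trans (Finset.sum_le_sum fun j hj => ?_)
        have hj' := Finset.mem_range.1 hj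
        rw [abs_mul]
        gcongr
        · exact hL j hj' _ hm
        · refine he _ (hlo.trans (by positivity)) (le_trans ?_ hnode)
          gcongr
          omega
    _ = _ := by simp; ring

end Discrete

/-! ### Differences, interpolation and small increments along one coordinate -/

section OneCoordinate

variable {d : ℕ}

theorem measurable_update_of {i : Fin d} {α : Type*} [MeasurableSpace α] {g : α → Fin d → ℝ}
    {c : α → ℝ} (hg : Measurable g) (hc : Measurable c) :
    Measurable fun z => Function.update (g z) i (c z) :=
  measurable_update'.comp (hg.prodMk hc)

theorem update_mem_Icc {a b x : Fin d → ℝ} (hx : x ∈ Set.Icc a b) {i : Fin d} {c : ℝ}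
    (hc : c ∈ Set.Icc (a i) (b i)) : Function.update x i c ∈ Set.Icc a b := by
  constructor <;> intro k <;> by_cases hk : k = i
  · subst hk; simpa using hc.1
  · simpa [hk] using hx.1 k
  · subst hk; simpa using hc.2
  · simpa [hk] using hx.2 k

theorem apply_mem_Icc {a b x : Fin d → ℝ} (hx : x ∈ Set.Icc a b) (i : Fin d) :
    x i ∈ Set.Icc (a i) (b i) := ⟨hx.1 i, hx.2 i⟩

theorem Measurable.coordDiff {f : (Fin d → ℝ) → ℝ} (hf : Measurable f) (i : Fin d) (k : ℕ)
    (s : ℝ) : Measurable (coordDiff i k s f) := by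
  unfold MixedWhitney.coordDiff
  refine Finset.measurable_fun_sum _ fun j _ => Measurable.const_mul ?_ _
  exact hf.comp (measurable_update_of measurable_id ((measurable_pi_apply i).add_const _))

/-- The points of the box where the coordinate difference of order `r` and step `s` is defined. -/
def diffDomain (i : Fin d) (r : ℕ) (s : ℝ) (a b : Fin d → ℝ) : Set (Fin d → ℝ) :=
  {x | x ∈ Set.Icc a b ∧ x i + r * s ∈ Set.Icc (a i) (b i)}

theorem measurableSet_diffDomain (i : Fin d) (r : ℕ) (s : ℝ) (a b : Fin d → ℝ) :
    MeasurableSet (diffDomain i r s a b) :=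
  measurableSet_Icc.inter (measurableSet_Icc.preimage ((measurable_pi_apply i).add_const _))

/-- The coordinate difference, extended by zero outside its domain. -/
noncomputable def cutDiff (i : Fin d) (r : ℕ) (s : ℝ) (a b : Fin d → ℝ) (f : (Fin d → ℝ) → ℝ) :
    (Fin d → ℝ) → ℝ :=
  (diffDomain i r s a b).indicator (coordDiff i r s f)

theorem measurable_cutDiff {f : (Fin d → ℝ) → ℝ} (hf : Measurable f) (i : Fin d) (r : ℕ) (s : ℝ)
    (a b : Fin d → ℝ) : Measurable (cutDiff i r s a b f) :=
  (Measurable.coordDiff hf i r s).indicator (measurableSet_diffDomain i r s a b)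

theorem cutDiff_update_eq_seqDiff {f : (Fin d → ℝ) → ℝ} {i : Fin d} {r : ℕ} {u t : ℝ}
    {a b x : Fin d → ℝ} (hx : x ∈ Set.Icc a b) {l : ℤ}
    (h1 : t + l * u ∈ Set.Icc (a i) (b i)) (h2 : t + ((l : ℝ) + r) * u ∈ Set.Icc (a i) (b i)) :
    cutDiff i r u a b f (Function.update x i (t + l * u)) =
      seqDiff r (fun l => f (Function.update x i (t + l * u))) l := by
  rw [cutDiff, Set.indicator_of_mem]
  · unfold coordDiff seqDiff
    refine Finset.sum_congr rfl fun j _ => ?_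
    simp only [Function.update_idem, Function.update_self]
    push_cast
    ring_nf
  · refine ⟨update_mem_Icc hx h1, ?_⟩
    rw [Function.update_self]
    convert h2 using 1
    ring

theorem add_mul_mem_Icc {α β t u lo hi l : ℝ} (h1 : t + lo * u ∈ Set.Icc α β)
    (h2 : t + hi * u ∈ Set.Icc α β) (hl : lo ≤ l) (hl' : l ≤ hi) : t + l * u ∈ Set.Icc α β := by
  rcases le_total 0 u with hu | hu
  · exact ⟨h1.1.trans (by gcongr), le_trans (by gcongr) h2.2⟩
  · have h3 := mul_le_mul_of_nonpos_right hl hu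
    have h4 := mul_le_mul_of_nonpos_right hl' hu
    exact ⟨by linarith [h2.1], by linarith [h1.2]⟩

/-- Lagrange interpolation in the coordinate `i` at the nodes `y, y + v, …, y + (r - 1) v`. -/
noncomputable def interp (i : Fin d) (r : ℕ) (y v : ℝ) (f : (Fin d → ℝ) → ℝ) : (Fin d → ℝ) → ℝ :=
  fun x => ∑ j ∈ Finset.range r,
    (lagr r j).eval ((x i - y) / v) * f (Function.update x i (y + j * v))

/-- The discrete estimate along a line of step u, with the Lagrange coefficients moved from m / n to
a nearby τ. `A` may depend on n, but L does not: when |m / n - τ| ≤ 1 / n, the term carrying values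
of `f` has the small factor L / n. -/
theorem exists_abs_sub_interp_le (r : ℕ) {n : ℕ} (hn : 0 < n) (N R : ℕ) :
    ∃ A : ℝ, 0 ≤ A ∧ ∀ L : ℝ, (∀ j < r, ∀ x y, |x| ≤ (R : ℝ) → |y| ≤ (R : ℝ) →
        |(lagr r j).eval x - (lagr r j).eval y| ≤ L * |x - y|) →
      ∀ {d : ℕ} (i : Fin d) (a b : Fin d → ℝ) (f : (Fin d → ℝ) → ℝ) (x : Fin d → ℝ) (t u τ : ℝ)
        (lo hi m : ℤ), x ∈ Set.Icc a b → lo ≤ 0 → lo ≤ m → m ≤ hi → 0 ≤ hi →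
        (r - 1) * n ≤ hi → hi - lo ≤ N → t + lo * u ∈ Set.Icc (a i) (b i) →
        t + hi * u ∈ Set.Icc (a i) (b i) → |τ| ≤ R → |(m : ℝ) / n| ≤ R →
        |f (Function.update x i (t + m * u)) - ∑ j ∈ Finset.range r, (lagr r j).eval τ *
            f (Function.update x i (t + j * (n * u)))| ≤
          A * ∑ l ∈ Finset.Icc (-N : ℤ) N,
              |cutDiff i r u a b f (Function.update x i (t + l * u))| +
            L * |(m : ℝ) / n - τ| * ∑ j ∈ Finset.range r,
              |(Set.Icc a b).indicator f (Function.update x i (t + j * (n * u)))| := by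
  obtain ⟨A, hA0, hA⟩ := exists_seq_interp_bound (r := r) hn N
  refine ⟨A, hA0, fun L hL d i a b f x t u τ lo hi m hx hlo hlom hmhi hhi hnode hN h1 h2 hτ hm => ?_⟩
  have hcast : ∀ j : ℕ, t + (((j : ℤ) * (n : ℤ) : ℤ) : ℝ) * u = t + j * (n * u) := by
    intro j; push_cast; ring
  have h3 := hA (fun l => f (Function.update x i (t + l * u))) lo hi m hlo hlom hmhi hhi hnode hN
  simp only [hcast] at h3
  have h4 : ∑ l ∈ Finset.Icc lo (hi - r),
        |seqDiff r (fun l => f (Function.update x i (t + l * u))) l| ≤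
      ∑ l ∈ Finset.Icc (-N : ℤ) N, |cutDiff i r u a b f (Function.update x i (t + l * u))| := by
    calc _ = ∑ l ∈ Finset.Icc lo (hi - r),
          |cutDiff i r u a b f (Function.update x i (t + l * u))| := by
          refine Finset.sum_congr rfl fun l hl => ?_
          obtain ⟨hl1, hl2⟩ := Finset.mem_Icc.1 hl
          have hl2' : l + r ≤ hi := by omega
          have e1 : (lo : ℝ) ≤ l := by exact_mod_cast hl1
          have e2 : (l : ℝ) + r ≤ hi := by exact_mod_cast hl2'
          have e3 : (0 : ℝ) ≤ r := Nat.cast_nonneg r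
          rw [cutDiff_update_eq_seqDiff hx (add_mul_mem_Icc h1 h2 e1 (by linarith))
            (add_mul_mem_Icc h1 h2 (by linarith) e2)]
      _ ≤ _ := by
          refine Finset.sum_le_sum_of_subset_of_nonneg ?_ fun _ _ _ => abs_nonneg _
          intro l hl
          obtain ⟨hl1, hl2⟩ := Finset.mem_Icc.1 hl
          exact Finset.mem_Icc.2 ⟨by omega, by omega⟩
  have h5 : |∑ j ∈ Finset.range r, (lagr r j).eval ((m : ℝ) / n) *
          f (Function.update x i (t + j * (n * u))) -
        ∑ j ∈ Finset.range r, (lagr r j).eval τ * f (Function.update x i (t + j * (n * u)))| ≤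
      L * |(m : ℝ) / n - τ| * ∑ j ∈ Finset.range r,
        |(Set.Icc a b).indicator f (Function.update x i (t + j * (n * u)))| := by
    rw [← Finset.sum_sub_distrib, Finset.mul_sum]
    refine (Finset.abs_sum_le_sum_abs _ _).trans (Finset.sum_le_sum fun j hj => ?_)
    have hj' := Finset.mem_range.1 hj
    have e1 : ((j : ℤ) * (n : ℤ)) ≤ hi := by
      refine le_trans ?_ hnode
      gcongr
      omega
    have e2 : lo ≤ (j : ℤ) * (n : ℤ) := hlo.trans (by positivity)
    have hmem : Function.update x i (t + j * (n * u)) ∈ Set.Icc a b := by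
      rw [← hcast]
      exact update_mem_Icc hx (add_mul_mem_Icc h1 h2 (by exact_mod_cast e2) (by exact_mod_cast e1))
    rw [Set.indicator_of_mem hmem, ← sub_mul, abs_mul]
    gcongr
    exact hL j hj' _ _ hm hτ
  refine (abs_sub_le _ (∑ j ∈ Finset.range r, (lagr r j).eval ((m : ℝ) / n) *
          f (Function.update x i (t + j * (n * u)))) _).trans (add_le_add (h3.trans ?_) h5)
  gcongr

theorem eval_lagr_zero {r j : ℕ} (hr : 0 < r) (hj : j < r) :
    (lagr r j).eval 0 = if j = 0 then 1 else 0 := by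
  split_ifs with h
  · subst h
    have := Lagrange.eval_basis_self (s := Finset.range r) (v := fun k : ℕ => (k : ℝ))
      (Nat.cast_injective.injOn) (Finset.mem_range.2 hr)
    simpa [lagr] using this
  · have := Lagrange.eval_basis_of_ne (s := Finset.range r) (v := fun k : ℕ => (k : ℝ)) h
      (Finset.mem_range.2 hr)
    simpa [lagr] using this

theorem sum_lagr_zero_mul {r : ℕ} (hr : 0 < r) (g : ℕ → ℝ) :
    ∑ j ∈ Finset.range r, (lagr r j).eval 0 * g j = g 0 := by
  rw [Finset.sum_eq_single_of_mem 0 (Finset.mem_range.2 hr)]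
  · rw [eval_lagr_zero hr hr]; simp
  · intro j hj hj0
    rw [eval_lagr_zero hr (Finset.mem_range.1 hj), if_neg hj0, zero_mul]

/-- The increment of `f` in the coordinate `i`, extended by zero. -/
noncomputable def cutIncrement (i : Fin d) (u : ℝ) (a b : Fin d → ℝ) (f : (Fin d → ℝ) → ℝ) :
    (Fin d → ℝ) → ℝ :=
  (diffDomain i 1 u a b).indicator fun x => f (Function.update x i (x i + u)) - f x

theorem eLpNorm_shift (i : Fin d) (c : ℝ) {F : (Fin d → ℝ) → ℝ} (hF : Measurable F) (p : ℝ≥0∞) :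
    eLpNorm (fun x => F (Function.update x i (x i + c))) p volume = eLpNorm F p volume :=
  eLpNorm_comp_measurePreserving hF.aestronglyMeasurable (measurePreserving_update_add i c)

theorem measurable_shift (i : Fin d) (c : ℝ) {F : (Fin d → ℝ) → ℝ} (hF : Measurable F) :
    Measurable fun x => F (Function.update x i (x i + c)) :=
  hF.comp (measurable_update_of measurable_id ((measurable_pi_apply i).add_const _))

/-- Take m = 1 and τ = 0 on the grid of step u: at 0 the Lagrange coefficients reduce the
interpolant to f(x), so the increment is bounded by differences plus L / n times values of `f`. The
Boolean index records whether the grid starts at x in direction u or at x + u in direction -u. -/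
theorem abs_cutIncrement_le {r n : ℕ} (hr : 0 < r) (hn : 0 < n) :
    ∃ A : ℝ, 0 ≤ A ∧ ∀ L : ℝ, 0 ≤ L → (∀ j < r, ∀ x y, |x| ≤ ((2 * r : ℕ) : ℝ) →
        |y| ≤ ((2 * r : ℕ) : ℝ) → |(lagr r j).eval x - (lagr r j).eval y| ≤ L * |x - y|) →
      ∀ {d : ℕ} (i : Fin d) (a b : Fin d → ℝ) (f : (Fin d → ℝ) → ℝ) (u : ℝ),
        |u| * (2 * r * n) ≤ b i - a i → ∀ x,
        |cutIncrement i u a b f x| ≤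
          A * ∑ q ∈ Finset.Icc (-(r * n : ℕ) : ℤ) (r * n : ℕ) ×ˢ (Finset.univ : Finset Bool),
              |cutDiff i r (if q.2 then u else -u) a b f
                (Function.update x i (x i + (if q.2 then q.1 * u else u - q.1 * u)))| +
            L * (1 / n) * ∑ q ∈ Finset.range r ×ˢ (Finset.univ : Finset Bool),
              |(Set.Icc a b).indicator f (Function.update x i
                (x i + (if q.2 then q.1 * (n * u) else u - q.1 * (n * u))))| := by
  obtain ⟨A, hA0, hA⟩ := exists_abs_sub_interp_le r hn (r * n) (2 * r)
  refine ⟨A, hA0, fun L hL0 hL d i a b f u hu x => ?_⟩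
  have hnR : (1 : ℝ) ≤ n := by exact_mod_cast hn
  have hrR : (1 : ℝ) ≤ r := by exact_mod_cast hr
  by_cases hx : x ∈ diffDomain i 1 u a b
  swap
  · rw [cutIncrement, Set.indicator_of_notMem hx, abs_zero]
    positivity
  rw [cutIncrement, Set.indicator_of_mem hx]
  have hxi := apply_mem_Icc hx.1 i
  have hxu : x i + u ∈ Set.Icc (a i) (b i) := by simpa using hx.2
  have hn1 : |((1 : ℤ) : ℝ) / n - 0| = 1 / n := by
    rw [sub_zero, Int.cast_one, abs_of_nonneg (by positivity)]
  have hbd : |((1 : ℤ) : ℝ) / n| ≤ ((2 * r : ℕ) : ℝ) := by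
    rw [← sub_zero (((1 : ℤ) : ℝ) / n), hn1]
    have : 1 / (n : ℝ) ≤ 1 := (div_le_one (by linarith)).2 hnR
    push_cast
    linarith
  have hhi : ((r : ℤ) - 1) * n ≤ ((r * n : ℕ) : ℤ) := by
    push_cast
    nlinarith
  have hrn : (1 : ℤ) ≤ ((r * n : ℕ) : ℤ) := by
    exact_mod_cast Nat.mul_pos hr hn
  simp only [Finset.sum_product, Fintype.sum_bool, if_true, Bool.false_eq_true, if_false,
    Finset.sum_add_distrib]
  -- The grid has length |u| r n, at most half the side, so it fits when it starts from a suitable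
  -- one of the two endpoints.
  have hkey : x i + ((r * n : ℕ) : ℝ) * u ∈ Set.Icc (a i) (b i) ∨
      x i + u + ((r * n : ℕ) : ℝ) * (-u) ∈ Set.Icc (a i) (b i) := by
    have h3 : |u| * (r * n) ≤ (b i - a i) / 2 := by linarith
    have h4 : u * (r * n) ≤ |u| * (r * n) := by gcongr; exact le_abs_self u
    have h5 : -u * (r * n) ≤ |u| * (r * n) := by gcongr; exact neg_le_abs u
    have h6 : (1 : ℝ) ≤ r * n := by nlinarith
    push_cast
    obtain ⟨e1, e2⟩ := hxi
    obtain ⟨e3, e4⟩ := hxu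
    rcases le_total 0 u with h0 | h0 <;> rcases le_total (x i) ((a i + b i) / 2) with h | h
    · left; constructor <;> nlinarith
    · right; constructor <;> nlinarith
    · right; constructor <;> nlinarith
    · left; constructor <;> nlinarith
  rcases hkey with hk | hk
  · have h := hA L hL i a b f x (x i) u 0 0 ((r * n : ℕ) : ℤ) 1 hx.1 le_rfl (by norm_num) hrn
      (by positivity) hhi (by simp) (by simpa using hxi) (by exact_mod_cast hk)
      (by rw [abs_zero]; positivity) hbd
    rw [sum_lagr_zero_mul hr (fun j => f (Function.update x i (x i + j * (n * u)))), hn1] at h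
    simp only [Int.cast_one, one_mul, Nat.cast_zero, zero_mul, add_zero,
      Function.update_eq_self] at h
    refine h.trans ?_
    gcongr
    · exact le_add_of_nonneg_right (Finset.sum_nonneg fun _ _ => abs_nonneg _)
    · exact le_add_of_nonneg_right (Finset.sum_nonneg fun _ _ => abs_nonneg _)
  · have h := hA L hL i a b f x (x i + u) (-u) 0 0 ((r * n : ℕ) : ℤ) 1 hx.1 le_rfl (by norm_num)
      hrn (by positivity) hhi (by simp) (by simpa using hxu) (by exact_mod_cast hk)
      (by rw [abs_zero]; positivity) hbd
    rw [sum_lagr_zero_mul hr (fun j => f (Function.update x i (x i + u + j * (n * -u)))), hn1] at h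
    simp only [Int.cast_one, one_mul, Nat.cast_zero, zero_mul, mul_neg, ← sub_eq_add_neg,
      add_sub_assoc, sub_self, add_zero, sub_zero, Function.update_eq_self] at h
    rw [abs_sub_comm]
    refine h.trans ?_
    gcongr
    · exact le_add_of_nonneg_left (Finset.sum_nonneg fun _ _ => abs_nonneg _)
    · exact le_add_of_nonneg_left (Finset.sum_nonneg fun _ _ => abs_nonneg _)

/-- The order of quantifiers is the point: `K` is chosen before n, so K / n can later be made as
small as desired, while `C` may grow with n. -/
theorem exists_eLpNorm_cutIncrement_le {r : ℕ} (hr : 0 < r) (p : ℝ≥0∞) :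
    ∃ K : ℝ≥0∞, K ≠ ∞ ∧ ∀ n : ℕ, 0 < n → ∃ C : ℝ≥0∞, C ≠ ∞ ∧
      ∀ {d : ℕ} (i : Fin d) (a b : Fin d → ℝ) (f : (Fin d → ℝ) → ℝ) (M : ℝ≥0∞), Measurable f →
        (∀ s, |s| ≤ b i - a i → eLpNorm (cutDiff i r s a b f) p volume ≤ M) →
        ∀ u, |u| * (2 * r * n) ≤ b i - a i →
          eLpNorm (cutIncrement i u a b f) p volume ≤
            K * ENNReal.ofReal (1 / n) * eLpNorm ((Set.Icc a b).indicator f) p volume + C * M := by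
  obtain ⟨L, hL0, -, hL⟩ := exists_lagr_bound r ((2 * r : ℕ) : ℝ)
  refine ⟨ENNReal.LpAddConst p * (ENNReal.ofReal L * sumConst p (r * 2)),
    ENNReal.mul_ne_top (ENNReal.LpAddConst_lt_top p).ne
      (ENNReal.mul_ne_top ENNReal.ofReal_ne_top (sumConst_ne_top _ _)), fun n hn => ?_⟩
  obtain ⟨A, hA0, hA⟩ := abs_cutIncrement_le hr hn
  set J := Finset.Icc (-(r * n : ℕ) : ℤ) (r * n : ℕ) ×ˢ (Finset.univ : Finset Bool) with hJ
  set J' := Finset.range r ×ˢ (Finset.univ : Finset Bool) with hJ'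
  refine ⟨ENNReal.LpAddConst p * (ENNReal.ofReal A * sumConst p J.card),
    ENNReal.mul_ne_top (ENNReal.LpAddConst_lt_top p).ne
      (ENNReal.mul_ne_top ENNReal.ofReal_ne_top (sumConst_ne_top _ _)),
    fun {d} i a b f M hf hM u hu => ?_⟩
  have hpt := hA L hL0 hL i a b f u hu
  have hnR : (1 : ℝ) ≤ n := by exact_mod_cast hn
  have hrR : (1 : ℝ) ≤ r := by exact_mod_cast hr
  have hu' : |u| ≤ b i - a i := by
    refine (le_mul_of_one_le_right (abs_nonneg u) ?_).trans hu
    nlinarith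
  set D : ℤ × Bool → (Fin d → ℝ) → ℝ := fun q x => cutDiff i r (if q.2 then u else -u) a b f
    (Function.update x i (x i + (if q.2 then q.1 * u else u - q.1 * u)))
  set E : ℕ × Bool → (Fin d → ℝ) → ℝ := fun q x => (Set.Icc a b).indicator f
    (Function.update x i (x i + (if q.2 then q.1 * (n * u) else u - q.1 * (n * u))))
  have hind : Measurable ((Set.Icc a b).indicator f) := hf.indicator measurableSet_Icc
  have hDm : ∀ q, Measurable (D q) := fun q => measurable_shift i _ (measurable_cutDiff hf i r _ a b)
  have hEm : ∀ q, Measurable (E q) := fun q => measurable_shift i _ hind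
  have hG1m : Measurable fun x => A * ∑ q ∈ J, |D q x| :=
    (Finset.measurable_fun_sum _ fun q _ => by simpa using (hDm q).norm).const_mul _
  have hG2m : Measurable fun x => L * (1 / n) * ∑ q ∈ J', |E q x| :=
    (Finset.measurable_fun_sum _ fun q _ => by simpa using (hEm q).norm).const_mul _
  have hD : eLpNorm (fun x => A * ∑ q ∈ J, |D q x|) p volume ≤
      ENNReal.ofReal A * sumConst p J.card * M := by
    refine eLpNorm_le_of_abs_le_sum J hA0 (fun q _ => (hDm q).aestronglyMeasurable)
      (Filter.Eventually.of_forall fun x => (abs_of_nonneg (by positivity)).le) fun q _ => ?_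
    refine (eLpNorm_shift i _ (measurable_cutDiff hf i r _ a b) p).le.trans (hM _ ?_)
    split_ifs
    · exact hu'
    · rwa [abs_neg]
  have hE : eLpNorm (fun x => L * (1 / n) * ∑ q ∈ J', |E q x|) p volume ≤
      ENNReal.ofReal (L * (1 / n)) * sumConst p (r * 2) *
        eLpNorm ((Set.Icc a b).indicator f) p volume := by
    have hcard : J'.card = r * 2 := by simp [hJ']
    rw [← hcard]
    exact eLpNorm_le_of_abs_le_sum J' (by positivity) (fun q _ => (hEm q).aestronglyMeasurable)
      (Filter.Eventually.of_forall fun x => (abs_of_nonneg (by positivity)).le)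
      fun q _ => (eLpNorm_shift i _ hind p).le
  calc eLpNorm (cutIncrement i u a b f) p volume
      ≤ eLpNorm ((fun x => A * ∑ q ∈ J, |D q x|) + fun x => L * (1 / n) * ∑ q ∈ J', |E q x|)
          p volume := eLpNorm_mono_real hpt
    _ ≤ ENNReal.LpAddConst p * (eLpNorm (fun x => A * ∑ q ∈ J, |D q x|) p volume +
          eLpNorm (fun x => L * (1 / n) * ∑ q ∈ J', |E q x|) p volume) :=
        eLpNorm_add_le' hG1m.aestronglyMeasurable hG2m.aestronglyMeasurable p
    _ ≤ ENNReal.LpAddConst p * (ENNReal.ofReal A * sumConst p J.card * M +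
          ENNReal.ofReal (L * (1 / n)) * sumConst p (r * 2) *
            eLpNorm ((Set.Icc a b).indicator f) p volume) := by gcongr
    _ = _ := by rw [ENNReal.ofReal_mul hL0]; ring

end OneCoordinate

/-! ### Averaging over the origin of the grid -/

section Averaging

variable {d : ℕ}

/-- Rounding towards zero. -/
noncomputable def truncZ (t : ℝ) : ℤ := if 0 ≤ t then ⌊t⌋ else ⌈t⌉

theorem measurable_truncZ : Measurable truncZ :=
  Measurable.ite measurableSet_Ici Int.measurable_floor Int.measurable_ceil

theorem truncZ_spec (t : ℝ) :
    (0 ≤ t ∧ 0 ≤ truncZ t ∧ (truncZ t : ℝ) ≤ t ∧ t ≤ truncZ t + 1) ∨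
      (t ≤ 0 ∧ truncZ t ≤ 0 ∧ t ≤ (truncZ t : ℝ) ∧ (truncZ t : ℝ) ≤ t + 1) := by
  unfold truncZ
  split_ifs with h
  · exact Or.inl ⟨h, Int.floor_nonneg.2 h, Int.floor_le t, (Int.lt_floor_add_one t).le⟩
  · push Not at h
    refine Or.inr ⟨h.le, ?_, Int.le_ceil t, (Int.ceil_lt_add_one t).le⟩
    exact Int.ceil_le.2 (by simpa using h.le)

theorem abs_sub_truncZ_le (t : ℝ) : |t - truncZ t| ≤ 1 := by
  rw [abs_le]
  rcases truncZ_spec t with h | h <;> constructor <;> linarith [h.2.2.1, h.2.2.2]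

theorem abs_truncZ_le {t : ℝ} {N : ℕ} (h : |t| ≤ N) : |truncZ t| ≤ (N : ℤ) := by
  obtain ⟨h1, h2⟩ := abs_le.1 h
  have : |(truncZ t : ℝ)| ≤ N := by
    rw [abs_le]
    rcases truncZ_spec t with h | h
    · have : (0 : ℝ) ≤ truncZ t := by exact_mod_cast h.2.1
      constructor <;> linarith [h.2.2.1]
    · have : (truncZ t : ℝ) ≤ 0 := by exact_mod_cast h.2.1
      constructor <;> linarith [h.2.2.1]
  exact_mod_cast this

/-- The point `(y, x)` is sent to the offset of `x i` from the grid `y + h ℤ`, together with `x`. -/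
noncomputable def gridOffset (i : Fin d) (h : ℝ) (z : ℝ × (Fin d → ℝ)) : ℝ × (Fin d → ℝ) :=
  (z.2 i - z.1 - h * truncZ ((z.2 i - z.1) / h), z.2)

theorem measurable_gridOffset (i : Fin d) (h : ℝ) : Measurable (gridOffset i h) := by
  have h1 : Measurable fun z : ℝ × (Fin d → ℝ) => z.2 i - z.1 := by fun_prop
  have h2 : Measurable fun z : ℝ × (Fin d → ℝ) => (truncZ ((z.2 i - z.1) / h) : ℝ) :=
    (measurable_from_top (f := fun m : ℤ => (m : ℝ))).comp
      (measurable_truncZ.comp (h1.div_const h))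
  exact (h1.sub (h2.const_mul h)).prodMk measurable_snd

theorem measurePreserving_offset (i : Fin d) (c : ℝ) :
    MeasurePreserving (fun z : ℝ × (Fin d → ℝ) => (z.2 i - z.1 - c, z.2))
      (volume.prod volume) (volume.prod volume) := by
  have hneg : MeasurePreserving (fun z : ℝ × (Fin d → ℝ) => (-z.1, z.2))
      (volume.prod volume) (volume.prod volume) :=
    (Measure.measurePreserving_neg (volume : Measure ℝ)).prod (MeasurePreserving.id volume)
  have htr : MeasurePreserving (fun z : ℝ × (Fin d → ℝ) => (z.1 + -c, z.2))
      (volume.prod volume) (volume.prod volume) :=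
    (measurePreserving_add_right (volume : Measure ℝ) (-c)).prod (MeasurePreserving.id volume)
  convert htr.comp ((measurePreserving_shear_fst i).comp hneg) using 1
  ext z
  · simp only [Function.comp_apply]; ring
  · rfl

/-- On each set where the rounded quotient is a fixed m, the map is a measure-preserving affine map.
There are at most 2N + 1 such pieces, and the offset lies in [-h, h], so the push-forward is
comparable with a uniform offset independent of x. -/
theorem map_gridOffset_le {i : Fin d} {a b : Fin d → ℝ} {h : ℝ} (hh : 0 < h) {N : ℕ}
    (hN : b i - a i = N * h) (hN0 : 0 < N) {ν : Measure ℝ} [SFinite ν]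
    (hν : ν ≤ ENNReal.ofReal (2 / (b i - a i)) • volume.restrict (Set.Icc (a i) (b i))) :
    Measure.map (gridOffset i h) (ν.prod (volume.restrict (Set.Icc a b))) ≤
      ENNReal.ofReal 12 •
        ((ENNReal.ofReal (1 / (2 * h)) • volume.restrict (Set.Icc (-h) h)).prod volume) := by
  have hm := measurable_gridOffset i h
  set vol2 : Measure (ℝ × (Fin d → ℝ)) := (volume : Measure ℝ).prod volume with hvol2
  refine Measure.le_iff.2 fun A hA => ?_
  rw [Measure.map_apply hm hA]
  have hle : ν.prod (volume.restrict (Set.Icc a b)) ≤ ENNReal.ofReal (2 / (b i - a i)) •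
        vol2.restrict (Set.Icc (a i) (b i) ×ˢ Set.Icc a b) := by
    calc ν.prod (volume.restrict (Set.Icc a b))
        ≤ (ENNReal.ofReal (2 / (b i - a i)) • volume.restrict (Set.Icc (a i) (b i))).prod
            (volume.restrict (Set.Icc a b)) := Measure.prod_mono hν le_rfl
      _ = _ := by rw [Measure.prod_smul_left, Measure.prod_restrict]
  set A' : Set (ℝ × (Fin d → ℝ)) := A ∩ Set.Icc (-h) h ×ˢ Set.univ
  have hA' : MeasurableSet A' := hA.inter (measurableSet_Icc.prod MeasurableSet.univ)
  have hcover : gridOffset i h ⁻¹' A ∩ Set.Icc (a i) (b i) ×ˢ Set.Icc a b ⊆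
      ⋃ m ∈ Finset.Icc (-N : ℤ) N,
        (fun z : ℝ × (Fin d → ℝ) => (z.2 i - z.1 - h * m, z.2)) ⁻¹' A' := by
    rintro z ⟨hzA, hz1, hz2⟩
    set t := (z.2 i - z.1) / h with ht
    have hxi := apply_mem_Icc hz2 i
    have htN : |t| ≤ N := by
      rw [ht, abs_div, abs_of_pos hh, div_le_iff₀ hh, ← hN, abs_le]
      constructor <;> linarith [hxi.1, hxi.2, hz1.1, hz1.2]
    have hmN := abs_le.1 (abs_truncZ_le htN)
    refine Set.mem_biUnion (x := truncZ t) (Finset.mem_Icc.2 hmN) ⟨hzA, ?_, trivial⟩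
    have hth : z.2 i - z.1 = h * t := by rw [ht]; field_simp
    have h1 := abs_le.1 (abs_sub_truncZ_le t)
    change z.2 i - z.1 - h * truncZ t ∈ Set.Icc (-h) h
    rw [hth]
    constructor <;> nlinarith
  have hcount : vol2 (gridOffset i h ⁻¹' A ∩ Set.Icc (a i) (b i) ×ˢ Set.Icc a b) ≤
      ((2 * N + 1 : ℕ) : ℝ≥0∞) * vol2 A' := by
    refine (measure_mono hcover).trans ((measure_biUnion_finset_le _ _).trans ?_)
    have : ∀ m ∈ Finset.Icc (-N : ℤ) N,
        vol2 ((fun z : ℝ × (Fin d → ℝ) => (z.2 i - z.1 - h * m, z.2)) ⁻¹' A') = vol2 A' :=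
      fun m _ => (measurePreserving_offset i (h * m)).measure_preimage hA'.nullMeasurableSet
    rw [Finset.sum_congr rfl this, Finset.sum_const, Int.card_Icc, nsmul_eq_mul]
    gcongr
    omega
  have hNR : (1 : ℝ) ≤ N := by exact_mod_cast hN0
  have hδ : 0 < b i - a i := by rw [hN]; positivity
  calc ν.prod (volume.restrict (Set.Icc a b)) (gridOffset i h ⁻¹' A)
      ≤ ENNReal.ofReal (2 / (b i - a i)) *
        vol2.restrict (Set.Icc (a i) (b i) ×ˢ Set.Icc a b) (gridOffset i h ⁻¹' A) := hle _
    _ ≤ ENNReal.ofReal (2 / (b i - a i)) * (((2 * N + 1 : ℕ) : ℝ≥0∞) * vol2 A') := by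
        rw [Measure.restrict_apply (hm hA)]
        exact mul_le_mul_right hcount _
    -- With 2N + 1 ≤ 3N, the density is at most (2 / (N h)) · 3N = 6 / h = 12 · 1 / (2h).
    _ ≤ ENNReal.ofReal 12 * (ENNReal.ofReal (1 / (2 * h)) * vol2 A') := by
        rw [← mul_assoc, ← mul_assoc, ← ENNReal.ofReal_natCast, ← ENNReal.ofReal_mul (by positivity),
          ← ENNReal.ofReal_mul (by norm_num)]
        refine mul_le_mul_left (ENNReal.ofReal_le_ofReal ?_) _
        rw [hN, div_mul_eq_mul_div, mul_one_div, div_le_div_iff₀ (by positivity) (by positivity)]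
        push_cast
        nlinarith
    _ = _ := by
        rw [Measure.prod_smul_left, ← Measure.restrict_univ (μ := (volume : Measure (Fin d → ℝ))),
          Measure.prod_restrict, Measure.smul_apply, Measure.smul_apply,
          smul_eq_mul, smul_eq_mul, Measure.restrict_apply hA]

theorem measurable_cutIncrement_prod {f : (Fin d → ℝ) → ℝ} (hf : Measurable f) (i : Fin d)
    (a b : Fin d → ℝ) :
    Measurable fun z : ℝ × (Fin d → ℝ) => cutIncrement i (-z.1) a b f z.2 := by
  have hs : MeasurableSet {z : ℝ × (Fin d → ℝ) | z.2 ∈ diffDomain i 1 (-z.1) a b} := by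
    refine (measurableSet_Icc.preimage measurable_snd).inter
      (measurableSet_Icc.preimage (f := fun z : ℝ × (Fin d → ℝ) => z.2 i + (1 : ℕ) * -z.1) ?_)
    fun_prop
  have hu : Measurable fun z : ℝ × (Fin d → ℝ) => Function.update z.2 i (z.2 i + -z.1) :=
    measurable_update_of measurable_snd (by fun_prop)
  exact ((hf.comp hu).sub (hf.comp measurable_snd)).indicator hs

theorem Measurable.interp {f : (Fin d → ℝ) → ℝ} (hf : Measurable f) (i : Fin d) (r : ℕ)
    (y v : ℝ) : Measurable (interp i r y v f) := by
  unfold MixedWhitney.interp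
  refine Finset.measurable_fun_sum _ fun j _ => Measurable.mul ?_ ?_
  · exact (lagr r j).continuous.measurable.comp (by fun_prop)
  · exact hf.comp (measurable_update_of measurable_id measurable_const)

theorem measurable_interp_prod {f : (Fin d → ℝ) → ℝ} (hf : Measurable f) (i : Fin d) (r : ℕ)
    (v : ℝ) : Measurable fun z : ℝ × (Fin d → ℝ) => interp i r z.1 v f z.2 := by
  unfold MixedWhitney.interp
  refine Finset.measurable_fun_sum _ fun j _ => Measurable.mul ?_ ?_
  · exact (lagr r j).continuous.measurable.comp (by fun_prop)
  · exact hf.comp (measurable_update_of measurable_snd (by fun_prop))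

/-- A function is approximated by its interpolation polynomials in one coordinate, up to a small
multiple of its own norm and a multiple of its modulus of smoothness in this coordinate. -/
theorem exists_eLpNorm_sub_interp_le {r : ℕ} (hr : 0 < r) {p : ℝ≥0∞} (hp : p ≠ 0) {ε : ℝ≥0∞}
    (hε : ε ≠ 0) :
    ∃ C : ℝ≥0∞, C ≠ ∞ ∧
      ∀ {d : ℕ} (i : Fin d) (a b : Fin d → ℝ) (f : (Fin d → ℝ) → ℝ) (M : ℝ≥0∞), a i < b i →
        Measurable f →
        (∀ s, |s| ≤ b i - a i → eLpNorm (cutDiff i r s a b f) p volume ≤ M) →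
        ∃ y v, eLpNorm (fun x => f x - interp i r y v f x) p (volume.restrict (Set.Icc a b)) ≤
          ε * eLpNorm f p (volume.restrict (Set.Icc a b)) + C * M := by
  obtain ⟨K, hK, hKC⟩ := exists_eLpNorm_cutIncrement_le hr p
  obtain ⟨L, hL0, -, hL⟩ := exists_lagr_bound r ((2 * r : ℕ) : ℝ)
  set c1 : ℝ≥0∞ := ENNReal.ofReal 12 ^ (1 / p).toReal
  set c2 : ℝ≥0∞ := 2 ^ (1 / p).toReal
  have hc1 : c1 ≠ ∞ := ENNReal.rpow_ne_top_of_nonneg ENNReal.toReal_nonneg ENNReal.ofReal_ne_top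
  have hc2 : c2 ≠ ∞ := ENNReal.rpow_ne_top_of_nonneg ENNReal.toReal_nonneg ENNReal.ofNat_ne_top
  set Z : ℝ≥0∞ := sumConst p 3 * (c1 * K + ENNReal.ofReal L * sumConst p r * c2)
  have hZ : Z ≠ ∞ := by
    refine ENNReal.mul_ne_top (sumConst_ne_top _ _) (ENNReal.add_ne_top.2
      ⟨ENNReal.mul_ne_top hc1 hK, ENNReal.mul_ne_top
        (ENNReal.mul_ne_top ENNReal.ofReal_ne_top (sumConst_ne_top _ _)) hc2⟩)
  -- Z gathers the coefficients of ‖f‖ / n in the total error and is independent of n.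
  obtain ⟨n, hn, hnε⟩ : ∃ n : ℕ, 0 < n ∧ Z * ENNReal.ofReal (1 / n) ≤ ε := by
    by_cases hZ0 : Z = 0
    · exact ⟨1, one_pos, by simp [hZ0]⟩
    obtain ⟨n, hn⟩ := ENNReal.exists_inv_nat_lt (ENNReal.div_ne_zero.2 ⟨hε, hZ⟩)
    have hn0 : 0 < n := by
      rcases Nat.eq_zero_or_pos n with h0 | h0
      · simp [h0] at hn
      · exact h0
    refine ⟨n, hn0, ?_⟩
    rw [one_div, ENNReal.ofReal_inv_of_pos (by exact_mod_cast hn0), ENNReal.ofReal_natCast]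
    calc Z * (n : ℝ≥0∞)⁻¹ ≤ Z * (ε / Z) := by gcongr
      _ = ε := ENNReal.mul_div_cancel hZ0 hZ
  obtain ⟨C1, hC1, hinc⟩ := hKC n hn
  -- The grid indices between 0, m and (r - 1)n span at most 3rn, since |m| ≤ 2rn; the arguments of
  -- the Lagrange polynomials are at most 2r in modulus.
  obtain ⟨A, hA0, hA⟩ := exists_abs_sub_interp_le r hn (3 * r * n) (2 * r)
  set J := Finset.Icc (-(3 * r * n : ℕ) : ℤ) (3 * r * n : ℕ) with hJ
  refine ⟨sumConst p 3 * (c1 * C1 + ENNReal.ofReal A * sumConst p J.card * c2), ?_,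
    fun {d} i a b f M hab hf hM => ?_⟩
  · exact ENNReal.mul_ne_top (sumConst_ne_top _ _) (ENNReal.add_ne_top.2
      ⟨ENNReal.mul_ne_top hc1 hC1, ENNReal.mul_ne_top
        (ENNReal.mul_ne_top ENNReal.ofReal_ne_top (sumConst_ne_top _ _)) hc2⟩)
  have hnR : (1 : ℝ) ≤ n := by exact_mod_cast hn
  have hrR : (1 : ℝ) ≤ r := by exact_mod_cast hr
  have hδ : 0 < b i - a i := sub_pos.2 hab
  set h : ℝ := (b i - a i) / (2 * r * n) with hh
  have hhpos : 0 < h := by positivity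
  have hδh : b i - a i = ((2 * r * n : ℕ) : ℝ) * h := by
    rw [hh]; push_cast; field_simp
  -- With y in the lower half of the side, the nodes y + j n h, j < r, stay in the box, because r n
  -- h is half the side.
  set I : Set ℝ := Set.Icc (a i) ((a i + b i) / 2)
  set ν : Measure ℝ := ENNReal.ofReal (2 / (b i - a i)) • volume.restrict I with hν
  set κ : Measure ℝ := ENNReal.ofReal (1 / (2 * h)) • volume.restrict (Set.Icc (-h) h) with hκ
  have hνP : IsProbabilityMeasure ν := by
    refine ⟨?_⟩
    rw [hν, Measure.smul_apply, Measure.restrict_apply_univ, Real.volume_Icc, smul_eq_mul,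
      ← ENNReal.ofReal_mul (by positivity)]
    convert ENNReal.ofReal_one using 2
    field_simp
    ring
  have hκP : IsProbabilityMeasure κ := by
    refine ⟨?_⟩
    rw [hκ, Measure.smul_apply, Measure.restrict_apply_univ, Real.volume_Icc, smul_eq_mul,
      ← ENNReal.ofReal_mul (by positivity)]
    convert ENNReal.ofReal_one using 2
    field_simp
    ring
  have hν1 : ν ≤ ENNReal.ofReal (2 / (b i - a i)) • volume.restrict (Set.Icc (a i) (b i)) := by
    have hsub : I ⊆ Set.Icc (a i) (b i) := Set.Icc_subset_Icc_right (by linarith)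
    exact Measure.le_iff.2 fun s _ =>
      mul_le_mul_right (Measure.restrict_mono hsub (le_refl volume) s) _
  have hν2 : ν ≤ ENNReal.ofReal (2 / (b i - a i)) • volume := by
    exact Measure.le_iff.2 fun s _ => mul_le_mul_right (Measure.restrict_le_self s) _
  set X := (Set.Icc a b).indicator f
  have hX : Measurable X := hf.indicator measurableSet_Icc
  have hXn : eLpNorm X p volume = eLpNorm f p (volume.restrict (Set.Icc a b)) :=
    eLpNorm_indicator_eq_eLpNorm_restrict measurableSet_Icc
  set F1 : ℝ × (Fin d → ℝ) → ℝ := fun z => cutIncrement i (-z.1) a b f z.2 with hF1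
  have hF1m : Measurable F1 := measurable_cutIncrement_prod hf i a b
  set G1 : ℝ × (Fin d → ℝ) → ℝ := fun z => F1 (gridOffset i h z) with hG1
  set D : ℤ → ℝ × (Fin d → ℝ) → ℝ := fun l z =>
    cutDiff i r h a b f (Function.update z.2 i (z.1 + l * h))
  set E : ℕ → ℝ × (Fin d → ℝ) → ℝ := fun j z => X (Function.update z.2 i (z.1 + j * (n * h)))
  have hDm : ∀ l, Measurable (D l) := fun l =>
    (measurable_cutDiff hf i r h a b).comp (measurable_update_prod i _)
  have hEm : ∀ j, Measurable (E j) := fun j => hX.comp (measurable_update_prod i _)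
  set G2 : ℝ × (Fin d → ℝ) → ℝ := fun z => A * ∑ l ∈ J, |D l z| with hG2
  set G3 : ℝ × (Fin d → ℝ) → ℝ := fun z => L * (1 / n) * ∑ j ∈ Finset.range r, |E j z| with hG3
  have hG1m : Measurable G1 := hF1m.comp (measurable_gridOffset i h)
  have hG2m : Measurable G2 :=
    (Finset.measurable_fun_sum _ fun q _ => by simpa using (hDm q).norm).const_mul _
  have hG3m : Measurable G3 :=
    (Finset.measurable_fun_sum _ fun q _ => by simpa using (hEm q).norm).const_mul _
  set π := ν.prod (volume.restrict (Set.Icc a b)) with hπ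
  have hB1 : eLpNorm G1 p π ≤ c1 * (K * ENNReal.ofReal (1 / n) * eLpNorm X p volume + C1 * M) := by
    refine (eLpNorm_comp_le_of_map_le (by simp) (measurable_gridOffset i h).aemeasurable
      (map_gridOffset_le hhpos hδh (by positivity) hν1) hF1m).trans ?_
    gcongr
    refine eLpNorm_prod_le_of_slice_le hp hF1m ?_
    have hmem : ∀ᵐ w ∂κ, w ∈ Set.Icc (-h) h :=
      Measure.ae_smul_measure (ae_restrict_mem measurableSet_Icc) _
    filter_upwards [hmem] with w hw
    refine hinc i a b f M hf hM (-w) ?_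
    rw [abs_neg, hδh]
    push_cast
    rw [mul_comm]
    gcongr
    exact abs_le.2 hw
  have hB2 : eLpNorm G2 p π ≤ ENNReal.ofReal A * sumConst p J.card * (c2 * M) := by
    refine eLpNorm_le_of_abs_le_sum J hA0 (fun q _ => (hDm q).aestronglyMeasurable)
      (Filter.Eventually.of_forall fun x => (abs_of_nonneg (by positivity)).le) fun q _ => ?_
    refine (eLpNorm_update_prod_le hab _ hν2 p (measurable_cutDiff hf i r h a b)).trans ?_
    gcongr
    refine hM _ ?_
    rw [abs_of_pos hhpos, hδh]
    refine le_mul_of_one_le_left hhpos.le ?_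
    push_cast
    nlinarith
  have hB3 : eLpNorm G3 p π ≤
      ENNReal.ofReal (L * (1 / n)) * sumConst p r * (c2 * eLpNorm X p volume) := by
    have := eLpNorm_le_of_abs_le_sum (p := p) (μ := π) (F := G3) (Finset.range r)
      (B := c2 * eLpNorm X p volume)
      (by positivity) (fun q _ => (hEm q).aestronglyMeasurable)
      (Filter.Eventually.of_forall fun x => (abs_of_nonneg (by positivity)).le)
      fun q _ => eLpNorm_update_prod_le hab _ hν2 p hX
    rwa [Finset.card_range] at this
  -- With m the rounded value of (x i - y) / h, G1 is the increment from x to the grid point y + m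
  -- h, G2 is the discrete interpolation error there, and G3 is the cost of evaluating the Lagrange
  -- coefficients at (x i - y) / (n h) instead of m / n.
  have hpt : ∀ᵐ z ∂π, |f z.2 - interp i r z.1 (n * h) f z.2| ≤
      1 * ∑ q : Fin 3, |(![G1, G2, G3] : Fin 3 → ℝ × (Fin d → ℝ) → ℝ) q z| := by
    have hmem : ∀ᵐ z ∂π, z ∈ I ×ˢ Set.Icc a b := by
      rw [hπ, hν, Measure.prod_smul_left, Measure.prod_restrict]
      exact Measure.ae_smul_measure
        (ae_restrict_mem (measurableSet_Icc.prod measurableSet_Icc)) _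
    filter_upwards [hmem] with z hz
    obtain ⟨y, x⟩ := z
    obtain ⟨⟨hy1, hy2⟩, hx⟩ := hz
    simp only at hy1 hy2 hx ⊢
    obtain ⟨hx1, hx2⟩ := apply_mem_Icc hx i
    set t := (x i - y) / h with ht
    have hth : x i - y = t * h := by rw [ht]; field_simp
    set m := truncZ t with hm
    have htN : |t| ≤ ((2 * r * n : ℕ) : ℝ) := by
      rw [ht, abs_div, abs_of_pos hhpos, div_le_iff₀ hhpos, ← hδh, abs_le]
      constructor <;> linarith
    have hmN := abs_truncZ_le htN
    rw [← hm] at hmN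
    have hmN' := abs_le.1 hmN
    have hmt := abs_sub_truncZ_le t
    rw [← hm] at hmt
    have hyI : y + ((0 : ℤ) : ℝ) * h ∈ Set.Icc (a i) (b i) := by
      rw [Int.cast_zero, zero_mul, add_zero]
      constructor <;> linarith
    -- Rounding towards zero puts y + m h between y and `x i`, hence in the side of the box.
    have hymI : y + (m : ℝ) * h ∈ Set.Icc (a i) (b i) := by
      rcases truncZ_spec t with ⟨h1, h2, h3, h4⟩ | ⟨h1, h2, h3, h4⟩
      · have h2' : (0 : ℝ) ≤ m := by exact_mod_cast h2
        constructor <;> nlinarith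
      · have h2' : (m : ℝ) ≤ 0 := by exact_mod_cast h2
        constructor <;> nlinarith
    have hynI : y + ((((r : ℤ) - 1) * n : ℤ) : ℝ) * h ∈ Set.Icc (a i) (b i) := by
      push_cast at hδh ⊢
      have h1 : 0 ≤ ((r : ℝ) - 1) * n * h := by
        have : (0 : ℝ) ≤ r - 1 := by linarith
        positivity
      have h2 : ((r : ℝ) - 1) * n * h = (b i - a i) / 2 - n * h := by rw [hδh]; ring
      have h3 : 0 ≤ n * h := by positivity
      constructor <;> linarith
    have hrn : 0 ≤ ((r : ℤ) - 1) * n := by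
      have : (0 : ℤ) ≤ (r : ℤ) - 1 := by omega
      positivity
    have hrn' : ((r : ℤ) - 1) * n ≤ (r * n : ℕ) := by push_cast; nlinarith
    have hmul : 2 * r * n = 2 * (r * n) := by ring
    have hmul' : 3 * r * n = 3 * (r * n) := by ring
    have hτ : (x i - y) / (n * h) = t / n := by
      rw [ht, div_div, mul_comm]
    have habsn : ∀ c : ℝ, |c| ≤ ((2 * r * n : ℕ) : ℝ) → |c / n| ≤ ((2 * r : ℕ) : ℝ) := by
      intro c hc
      rw [abs_div, Nat.abs_cast, div_le_iff₀ (by positivity)]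
      exact_mod_cast hc
    have hmain := hA L hL i a b f x y h ((x i - y) / (n * h)) (min 0 m)
      (max m (((r : ℤ) - 1) * n)) m hx (min_le_left _ _) (min_le_right _ _) (le_max_left _ _)
      (hrn.trans (le_max_right _ _)) (le_max_right _ _)
      (by rw [hmul']; rw [hmul] at hmN'; push_cast at *; omega)
      (by rcases min_choice 0 m with h0 | h0 <;> rw [h0]; exacts [hyI, hymI])
      (by rcases max_choice m (((r : ℤ) - 1) * n) with h0 | h0 <;> rw [h0]; exacts [hymI, hynI])
      (by rw [hτ]; exact habsn _ htN) (habsn _ (by exact_mod_cast hmN))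
    have hu : L * |(m : ℝ) / n - (x i - y) / (n * h)| ≤ L * (1 / n) := by
      gcongr
      rw [hτ, ← sub_div, abs_div, Nat.abs_cast, abs_sub_comm]
      gcongr
    have hG1v : G1 (y, x) = f (Function.update x i (y + m * h)) - f x := by
      have hpt : x i + -(x i - y - h * m) = y + m * h := by ring
      change cutIncrement i (-(x i - y - h * m)) a b f x = _
      rw [cutIncrement, Set.indicator_of_mem, hpt]
      refine ⟨hx, ?_⟩
      rw [Nat.cast_one, one_mul, hpt]
      exact hymI
    rw [one_mul, Fin.sum_univ_three]
    simp only [Matrix.cons_val_zero, Matrix.cons_val_one, Matrix.cons_val]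
    have hG23 := hmain.trans (add_le_add (le_abs_self (G2 (y, x))) (le_trans
      (mul_le_mul_of_nonneg_right hu (Finset.sum_nonneg fun _ _ => abs_nonneg _))
      (le_abs_self (G3 (y, x)))))
    rw [hG1v, abs_sub_comm (f (Function.update x i (y + m * h))), add_assoc]
    exact (abs_sub_le _ (f (Function.update x i (y + m * h))) _).trans (add_le_add le_rfl hG23)
  have htotal : eLpNorm (fun z : ℝ × (Fin d → ℝ) => f z.2 - interp i r z.1 (n * h) f z.2) p π ≤
      ε * eLpNorm X p volume +
        sumConst p 3 * (c1 * C1 + ENNReal.ofReal A * sumConst p J.card * c2) * M := by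
    have hsum := eLpNorm_le_of_abs_le_sum (p := p) (μ := π) (Finset.univ : Finset (Fin 3))
      (B := c1 * (K * ENNReal.ofReal (1 / n) * eLpNorm X p volume + C1 * M) +
        ENNReal.ofReal A * sumConst p J.card * (c2 * M) +
        ENNReal.ofReal (L * (1 / n)) * sumConst p r * (c2 * eLpNorm X p volume))
      zero_le_one (fun q _ => by
        fin_cases q
        exacts [hG1m.aestronglyMeasurable, hG2m.aestronglyMeasurable, hG3m.aestronglyMeasurable])
      hpt (fun q _ => by
        fin_cases q
        exacts [hB1.trans (le_self_add.trans le_self_add),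
          hB2.trans (le_add_self.trans le_self_add), hB3.trans le_add_self])
    refine hsum.trans ?_
    rw [ENNReal.ofReal_one, one_mul, Finset.card_univ, Fintype.card_fin, ENNReal.ofReal_mul hL0]
    calc _ = Z * ENNReal.ofReal (1 / n) * eLpNorm X p volume +
          sumConst p 3 * (c1 * C1 + ENNReal.ofReal A * sumConst p J.card * c2) * M := by ring
      _ ≤ _ := by gcongr
  obtain ⟨y, hy⟩ := exists_eLpNorm_slice_le hp (μ := volume.restrict (Set.Icc a b)) (ν := ν)
    (F := fun z : ℝ × (Fin d → ℝ) => f z.2 - interp i r z.1 (n * h) f z.2)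
    ((hf.comp measurable_snd).sub (measurable_interp_prod hf i r _))
  exact ⟨y, n * h, by rw [← hXn]; exact hy.trans htotal⟩

end Averaging

/-! ### Functions that are polynomials in single coordinates -/

section Polynomials

variable {d : ℕ}

/-- `g` is a polynomial of degree less than `n` in the coordinate `i`, the others being fixed. -/
def IsPolyIn (i : Fin d) (n : ℕ) (g : (Fin d → ℝ) → ℝ) : Prop :=
  ∀ x, ∃ P : Polynomial ℝ, P.degree < n ∧ ∀ s, g (Function.update x i s) = P.eval s

theorem degree_sub_lt_of_lt {P Q : Polynomial ℝ} {n : ℕ} (hP : P.degree < n) (hQ : Q.degree < n) :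
    (P - Q).degree < n :=
  lt_of_le_of_lt (Polynomial.degree_sub_le P Q) (max_lt hP hQ)

theorem degree_sum_lt_of_lt {ι : Type*} {s : Finset ι} {P : ι → Polynomial ℝ} {n : ℕ}
    (hP : ∀ j ∈ s, (P j).degree < n) : (∑ j ∈ s, P j).degree < n :=
  Polynomial.mem_degreeLT.1 (Submodule.sum_mem _ fun j hj => Polynomial.mem_degreeLT.2 (hP j hj))

theorem degree_C_mul_lt_of_lt {P : Polynomial ℝ} {n : ℕ} (c : ℝ) (hP : P.degree < n) :
    (Polynomial.C c * P).degree < n := by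
  rw [← Polynomial.smul_eq_C_mul]
  exact lt_of_le_of_lt (Polynomial.degree_smul_le c P) hP

theorem IsPolyIn.sub {i : Fin d} {n : ℕ} {f g : (Fin d → ℝ) → ℝ} (hf : IsPolyIn i n f)
    (hg : IsPolyIn i n g) : IsPolyIn i n (fun x => f x - g x) := fun x => by
  obtain ⟨P, hP, hP'⟩ := hf x
  obtain ⟨Q, hQ, hQ'⟩ := hg x
  exact ⟨P - Q, degree_sub_lt_of_lt hP hQ, fun s => by simp only [hP', hQ', Polynomial.eval_sub]⟩

theorem IsPolyIn.add {i : Fin d} {n : ℕ} {f g : (Fin d → ℝ) → ℝ} (hf : IsPolyIn i n f)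
    (hg : IsPolyIn i n g) : IsPolyIn i n (fun x => f x + g x) := fun x => by
  obtain ⟨P, hP, hP'⟩ := hf x
  obtain ⟨Q, hQ, hQ'⟩ := hg x
  exact ⟨P + Q, lt_of_le_of_lt (Polynomial.degree_add_le P Q) (max_lt hP hQ),
    fun s => by simp only [hP', hQ', Polynomial.eval_add]⟩

theorem IsPolyIn.sum_mul_update {i k : Fin d} (hk : k ≠ i) {n : ℕ} {g : (Fin d → ℝ) → ℝ}
    (hg : IsPolyIn k n g) {ι : Type*} (s : Finset ι) (c e : ι → ℝ → ℝ) :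
    IsPolyIn k n (fun x => ∑ j ∈ s, c j (x i) * g (Function.update x i (e j (x i)))) := fun x => by
  choose P hP hP' using fun j => hg (Function.update x i (e j (x i)))
  refine ⟨∑ j ∈ s, Polynomial.C (c j (x i)) * P j,
    degree_sum_lt_of_lt fun j _ => degree_C_mul_lt_of_lt _ (hP j), fun t => ?_⟩
  rw [Polynomial.eval_finsetSum]
  refine Finset.sum_congr rfl fun j _ => ?_
  rw [Polynomial.eval_mul, Polynomial.eval_C, ← hP', Function.update_of_ne hk.symm,
    Function.update_comm hk]

theorem IsPolyIn.interp_of_ne {i k : Fin d} (hk : k ≠ i) {n : ℕ} {g : (Fin d → ℝ) → ℝ}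
    (hg : IsPolyIn k n g) (r : ℕ) (y v : ℝ) : IsPolyIn k n (interp i r y v g) :=
  hg.sum_mul_update hk (Finset.range r) (fun j t => (lagr r j).eval ((t - y) / v))
    (fun j _ => y + j * v)

theorem IsPolyIn.coordDiff_of_ne {i k : Fin d} (hk : k ≠ i) {n : ℕ} {g : (Fin d → ℝ) → ℝ}
    (hg : IsPolyIn k n g) (m : ℕ) (s : ℝ) : IsPolyIn k n (coordDiff i m s g) :=
  hg.sum_mul_update hk (Finset.range (m + 1))
    (fun j _ => (-1 : ℝ) ^ (m - j) * (m.choose j : ℝ)) (fun j t => t + j * s)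

theorem isPolyIn_interp (i : Fin d) (r : ℕ) (y v : ℝ) (g : (Fin d → ℝ) → ℝ) :
    IsPolyIn i r (interp i r y v g) := fun x => by
  refine ⟨∑ j ∈ Finset.range r, Polynomial.C (g (Function.update x i (y + j * v))) *
    (lagr r j).comp (Polynomial.C v⁻¹ * Polynomial.X + Polynomial.C (-y * v⁻¹)),
    degree_sum_lt_of_lt fun j hj => degree_C_mul_lt_of_lt _ ?_, fun t => ?_⟩
  · have h1 := degree_lagr_lt (Finset.mem_range.1 hj)
    by_cases h0 : lagr r j = 0
    · simp [h0]
    rw [Polynomial.degree_eq_natDegree h0] at h1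
    refine lt_of_le_of_lt (Polynomial.degree_le_of_natDegree_le
      (Polynomial.natDegree_comp_le.trans ?_)) h1
    exact (Nat.mul_le_mul_left _ Polynomial.natDegree_linear_le).trans (mul_one _).le
  · rw [Polynomial.eval_finsetSum]
    refine Finset.sum_congr rfl fun j _ => ?_
    simp only [Function.update_self, Function.update_idem, Polynomial.eval_mul, Polynomial.eval_C,
      Polynomial.eval_comp, Polynomial.eval_add, Polynomial.eval_X]
    rw [mul_comm]
    congr 2
    rw [div_eq_mul_inv]
    ring

theorem coordDiff_eq_zero_of_isPolyIn {i : Fin d} {r : ℕ} {g : (Fin d → ℝ) → ℝ}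
    (hg : IsPolyIn i r g) (s : ℝ) : coordDiff i r s g = 0 := by
  funext x
  obtain ⟨P, hP, hP'⟩ := hg x
  simp only [coordDiff, hP']
  exact sum_diff_eval_eq_zero hP (x i) s

theorem coordDiff_sub (i : Fin d) (k : ℕ) (s : ℝ) (f g : (Fin d → ℝ) → ℝ) :
    coordDiff i k s (fun x => f x - g x) = fun x => coordDiff i k s f x - coordDiff i k s g x := by
  funext x
  simp only [coordDiff, ← Finset.sum_sub_distrib, mul_sub]

/-- A multivariate polynomial with bounded partial degrees is a polynomial in each coordinate. -/
theorem isPolyIn_eval {r : Fin d → ℕ} {P : MvPolynomial (Fin d) ℝ} (hP : P ∈ polySet r)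
    (i : Fin d) : IsPolyIn i (r i) (fun x => MvPolynomial.eval x P) := fun x => by
  classical
  have hPi : P.degreeOf i < r i := hP i
  refine ⟨∑ m ∈ P.support, Polynomial.C (P.coeff m * ∏ k ∈ Finset.univ.erase i, x k ^ m k) *
    Polynomial.X ^ m i, degree_sum_lt_of_lt fun m hm => degree_C_mul_lt_of_lt _ ?_, fun s => ?_⟩
  · rw [Polynomial.degree_X_pow]
    exact_mod_cast (MvPolynomial.degreeOf_lt_iff (by omega)).1 hPi m hm
  · beta_reduce
    rw [MvPolynomial.eval_eq', Polynomial.eval_finsetSum]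
    refine Finset.sum_congr rfl fun m _ => ?_
    rw [← Finset.prod_erase_mul _ _ (Finset.mem_univ i), Function.update_self]
    simp only [Polynomial.eval_mul, Polynomial.eval_C, Polynomial.eval_pow, Polynomial.eval_X,
      mul_assoc]
    congr 2
    refine Finset.prod_congr rfl fun k hk => ?_
    rw [Function.update_of_ne (Finset.ne_of_mem_erase hk)]

theorem eval_update_of_degreeOf_eq_zero {P : MvPolynomial (Fin d) ℝ} {i : Fin d}
    (hP : P.degreeOf i = 0) (x : Fin d → ℝ) (c : ℝ) :
    MvPolynomial.eval (Function.update x i c) P = MvPolynomial.eval x P := by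
  rw [MvPolynomial.eval_eq', MvPolynomial.eval_eq']
  refine Finset.sum_congr rfl fun m hm => ?_
  congr 1
  refine Finset.prod_congr rfl fun k _ => ?_
  by_cases hk : k = i
  · subst hk
    have : m k = 0 := by
      have := (MvPolynomial.degreeOf_lt_iff one_pos).1 (hP.trans_lt one_pos) m hm
      omega
    simp [this]
  · rw [Function.update_of_ne hk]

theorem degreeOf_aeval_X_le (i k : Fin d) (q : Polynomial ℝ) :
    (Polynomial.aeval (MvPolynomial.X i : MvPolynomial (Fin d) ℝ) q).degreeOf k ≤
      if k = i then q.natDegree else 0 := by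
  rw [Polynomial.aeval_eq_sum_range]
  refine (MvPolynomial.degreeOf_sum_le _ _ _).trans (Finset.sup_le fun n hn => ?_)
  rw [MvPolynomial.smul_eq_C_mul]
  refine (MvPolynomial.degreeOf_C_mul_le _ _ _).trans
    ((MvPolynomial.degreeOf_pow_le _ _ _).trans ?_)
  rw [MvPolynomial.degreeOf_X]
  have := Finset.mem_range.1 hn
  split_ifs with h
  · omega
  · simp

/-- A function that is a polynomial in each coordinate of `S` separately is a polynomial in these
coordinates. -/
theorem exists_mvPolynomial_of_isPolyIn {r : Fin d → ℕ} {g : (Fin d → ℝ) → ℝ}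
    (S : Finset (Fin d)) (hg : ∀ i ∈ S, IsPolyIn i (r i) g) (x₀ : Fin d → ℝ) :
    ∃ P : MvPolynomial (Fin d) ℝ, (∀ i ∈ S, P.degreeOf i ≤ r i - 1) ∧
      (∀ i ∉ S, P.degreeOf i = 0) ∧
      ∀ x, (∀ k ∉ S, x k = x₀ k) → g x = MvPolynomial.eval x P := by
  induction S using Finset.induction_on generalizing x₀ with
  | empty =>
    refine ⟨MvPolynomial.C (g x₀), by simp, by simp, fun x hx => ?_⟩
    rw [MvPolynomial.eval_C]
    congr 1
    funext k
    exact hx k (Finset.notMem_empty k)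
  | insert i S hi ih =>
    -- The induction hypothesis is used on the slices `x i = j`, j = 0, …, r i - 1; interpolation in
    -- `x i` glues these polynomials together.
    choose P hP1 hP2 hP3 using fun j : ℕ => ih (fun k hk => hg k (Finset.mem_insert_of_mem hk))
      (Function.update x₀ i (j : ℝ))
    have hdeg : ∀ k j, j < r i → (Polynomial.aeval (MvPolynomial.X i : MvPolynomial (Fin d) ℝ)
        (lagr (r i) j) * P j).degreeOf k ≤ (if k = i then r i - 1 else 0) + (P j).degreeOf k := by
      intro k j hj
      refine (MvPolynomial.degreeOf_mul_le _ _ _).trans ?_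
      gcongr
      refine (degreeOf_aeval_X_le i k _).trans ?_
      split_ifs
      · by_cases h0 : lagr (r i) j = 0
        · simp [h0]
        · have := degree_lagr_lt hj
          rw [Polynomial.degree_eq_natDegree h0] at this
          have : (lagr (r i) j).natDegree < r i := by exact_mod_cast this
          omega
      · exact le_rfl
    refine ⟨∑ j ∈ Finset.range (r i), Polynomial.aeval (MvPolynomial.X i) (lagr (r i) j) * P j,
      fun k hk => ?_, fun k hk => ?_, fun x hx => ?_⟩
    · refine (MvPolynomial.degreeOf_sum_le _ _ _).trans (Finset.sup_le fun j hj => ?_)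
      refine (hdeg k j (Finset.mem_range.1 hj)).trans ?_
      by_cases hki : k = i
      · subst hki
        rw [if_pos rfl, hP2 j k hi, add_zero]
      · rw [if_neg hki, zero_add]
        exact hP1 j k ((Finset.mem_insert.1 hk).resolve_left hki)
    · rw [Finset.mem_insert, not_or] at hk
      refine Nat.le_zero.1 ?_
      refine (MvPolynomial.degreeOf_sum_le _ _ _).trans (Finset.sup_le fun j hj => ?_)
      refine (hdeg k j (Finset.mem_range.1 hj)).trans ?_
      rw [if_neg hk.1, hP2 j k hk.2]
    · obtain ⟨Q, hQ, hQ'⟩ := hg i (Finset.mem_insert_self i S) x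
      have h1 : g x = Q.eval (x i) := by rw [← hQ', Function.update_eq_self]
      rw [h1, eval_eq_sum_lagr hQ, map_sum]
      refine Finset.sum_congr rfl fun j _ => ?_
      rw [map_mul, ← hQ', hP3 j _ fun k hk => ?_,
        eval_update_of_degreeOf_eq_zero (hP2 j i hi)]
      · congr 1
        rw [← MvPolynomial.coe_aeval_eq_eval, RingHom.coe_coe, ← Polynomial.aeval_algHom_apply,
          MvPolynomial.aeval_X, Polynomial.coe_aeval_eq_eval]
      · by_cases hki : k = i
        · subst hki; simp
        · simp only [Function.update_of_ne hki]
          exact hx k (by simp [hki, hk])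

end Polynomials

/-! ### The upper estimate: absorption and induction over the coordinates -/

section UpperBound

variable {d : ℕ}

theorem abs_coordDiff_le {A B : Set (Fin d → ℝ)} {i : Fin d} {k : ℕ} {s : ℝ}
    (hAB : ∀ x ∈ A, ∀ j ≤ k, Function.update x i (x i + j * s) ∈ B) (f : (Fin d → ℝ) → ℝ)
    {x : Fin d → ℝ} (hx : x ∈ A) :
    |coordDiff i k s f x| ≤ 2 ^ k * ∑ j ∈ Finset.range (k + 1),
      |B.indicator f (Function.update x i (x i + j * s))| := by
  rw [coordDiff, Finset.mul_sum]
  refine (Finset.abs_sum_le_sum_abs _ _).trans (Finset.sum_le_sum fun j hj => ?_)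
  rw [Set.indicator_of_mem (hAB x hx j (Nat.lt_succ_iff.1 (Finset.mem_range.1 hj))), abs_mul,
    abs_mul, abs_pow, abs_neg, abs_one, one_pow, one_mul, Nat.abs_cast]
  gcongr
  exact_mod_cast Nat.choose_le_two_pow k j

theorem eLpNorm_coordDiff_le {A B : Set (Fin d → ℝ)} (hA : MeasurableSet A) (hB : MeasurableSet B)
    {i : Fin d} {k : ℕ} {s : ℝ}
    (hAB : ∀ x ∈ A, ∀ j ≤ k, Function.update x i (x i + j * s) ∈ B) {f : (Fin d → ℝ) → ℝ}
    (hf : Measurable f) (p : ℝ≥0∞) :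
    eLpNorm (coordDiff i k s f) p (volume.restrict A) ≤
      ENNReal.ofReal (2 ^ k) * sumConst p (k + 1) * eLpNorm f p (volume.restrict B) := by
  have hind : Measurable (B.indicator f) := hf.indicator hB
  have h := eLpNorm_le_of_abs_le_sum (p := p) (μ := volume.restrict A) (F := coordDiff i k s f)
    (G := fun j x => B.indicator f (Function.update x i (x i + (j : ℝ) * s)))
    (B := eLpNorm f p (volume.restrict B)) (Finset.range (k + 1)) (c := 2 ^ k) (by positivity)
    (fun j _ => (measurable_shift i _ hind).aestronglyMeasurable)
    (by filter_upwards [ae_restrict_mem hA] with x hx using abs_coordDiff_le hAB f hx)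
    (fun j _ => (eLpNorm_mono_measure _ Measure.restrict_le_self).trans
      ((eLpNorm_shift i _ hind p).trans (eLpNorm_indicator_eq_eLpNorm_restrict hB)).le)
  rwa [Finset.card_range] at h

theorem update_mem_Icc_of_mem_diffDomain {i : Fin d} {r : ℕ} {s : ℝ} {a b x : Fin d → ℝ}
    (hx : x ∈ diffDomain i r s a b) {j : ℕ} (hj : j ≤ r) :
    Function.update x i (x i + j * s) ∈ Set.Icc a b :=
  update_mem_Icc hx.1 (add_mul_mem_Icc (lo := 0) (by simpa using apply_mem_Icc hx.1 i) hx.2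
    (Nat.cast_nonneg j) (by exact_mod_cast hj))

/-- The modulus of smoothness of order `r` in the coordinate `i`. -/
noncomputable def coordModulus (i : Fin d) (r : ℕ) (p : ℝ≥0∞) (a b : Fin d → ℝ)
    (f : (Fin d → ℝ) → ℝ) : ℝ≥0∞ :=
  ⨆ (s : ℝ) (_ : |s| ≤ b i - a i), eLpNorm (cutDiff i r s a b f) p volume

theorem le_coordModulus {i : Fin d} (r : ℕ) (p : ℝ≥0∞) {a b : Fin d → ℝ} (f : (Fin d → ℝ) → ℝ)
    {s : ℝ} (hs : |s| ≤ b i - a i) :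
    eLpNorm (cutDiff i r s a b f) p volume ≤ coordModulus i r p a b f :=
  le_iSup₂ (f := fun (s : ℝ) (_ : |s| ≤ b i - a i) => eLpNorm (cutDiff i r s a b f) p volume) s hs

theorem cutDiff_sub (i : Fin d) (r : ℕ) (s : ℝ) (a b : Fin d → ℝ) (f g : (Fin d → ℝ) → ℝ) :
    cutDiff i r s a b (fun x => f x - g x) = cutDiff i r s a b f - cutDiff i r s a b g := by
  rw [cutDiff, cutDiff, cutDiff, coordDiff_sub]
  exact Set.indicator_sub' _ _ _

theorem coordModulus_sub_of_isPolyIn {i : Fin d} {r : ℕ} {g : (Fin d → ℝ) → ℝ}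
    (hg : IsPolyIn i r g) (p : ℝ≥0∞) (a b : Fin d → ℝ) (f : (Fin d → ℝ) → ℝ) :
    coordModulus i r p a b (fun x => f x - g x) = coordModulus i r p a b f := by
  have h0 : ∀ s, cutDiff i r s a b g = 0 := fun s => by
    rw [cutDiff, coordDiff_eq_zero_of_isPolyIn hg, Set.indicator_zero']
  simp only [coordModulus, cutDiff_sub, h0, sub_zero]

theorem exists_coordModulus_le (r : ℕ) (p : ℝ≥0∞) :
    ∃ K : ℝ≥0∞, K ≠ ∞ ∧ ∀ {d : ℕ} (i : Fin d) (a b : Fin d → ℝ) (f g : (Fin d → ℝ) → ℝ),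
      Measurable f → Measurable g → coordModulus i r p a b g ≤
        K * (coordModulus i r p a b f +
          eLpNorm (fun x => f x - g x) p (volume.restrict (Set.Icc a b))) := by
  set c : ℝ≥0∞ := ENNReal.ofReal (2 ^ r) * sumConst p (r + 1)
  have hc : c ≠ ∞ := ENNReal.mul_ne_top ENNReal.ofReal_ne_top (sumConst_ne_top _ _)
  refine ⟨ENNReal.LpAddConst p * (1 + c), ENNReal.mul_ne_top (ENNReal.LpAddConst_lt_top p).ne
    (ENNReal.add_ne_top.2 ⟨ENNReal.one_ne_top, hc⟩), fun {d} i a b f g hf hg => ?_⟩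
  refine iSup₂_le fun s hs => ?_
  have h1 : cutDiff i r s a b g =
      cutDiff i r s a b f - cutDiff i r s a b (fun x => f x - g x) := by
    rw [cutDiff_sub, sub_sub_cancel]
  have h2 : eLpNorm (cutDiff i r s a b (fun x => f x - g x)) p volume ≤
      c * eLpNorm (fun x => f x - g x) p (volume.restrict (Set.Icc a b)) := by
    rw [cutDiff, eLpNorm_indicator_eq_eLpNorm_restrict (measurableSet_diffDomain i r s a b)]
    exact eLpNorm_coordDiff_le (measurableSet_diffDomain i r s a b) measurableSet_Icc
      (fun x hx j hj => update_mem_Icc_of_mem_diffDomain hx hj) (hf.sub hg) p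
  rw [h1]
  refine (eLpNorm_sub_le' (measurable_cutDiff hf i r s a b).aestronglyMeasurable
    (measurable_cutDiff (hf.sub hg) i r s a b).aestronglyMeasurable p).trans ?_
  rw [mul_assoc]
  gcongr
  calc _ ≤ coordModulus i r p a b f +
        c * eLpNorm (fun x => f x - g x) p (volume.restrict (Set.Icc a b)) :=
        add_le_add (le_coordModulus r p f hs) h2
    _ ≤ (1 + c) * coordModulus i r p a b f +
        (1 + c) * eLpNorm (fun x => f x - g x) p (volume.restrict (Set.Icc a b)) := by
        gcongr
        · exact le_mul_of_one_le_left zero_le le_self_add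
        · exact le_add_self
    _ = _ := by ring

/-- The measurable functions that are polynomials of degree less than `r i` in each coordinate
`i ∈ S`. -/
def polyClass (S : Finset (Fin d)) (r : Fin d → ℕ) : Set ((Fin d → ℝ) → ℝ) :=
  {g | Measurable g ∧ ∀ i ∈ S, IsPolyIn i (r i) g}

/-- The error of best approximation by functions that are polynomials in the coordinates of `S`. -/
noncomputable def partialError (S : Finset (Fin d)) (r : Fin d → ℕ) (p : ℝ≥0∞) (a b : Fin d → ℝ)
    (f : (Fin d → ℝ) → ℝ) : ℝ≥0∞ :=
  ⨅ g : polyClass S r, eLpNorm (fun x => f x - (g : (Fin d → ℝ) → ℝ) x) p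
    (volume.restrict (Set.Icc a b))

theorem partialError_le {S : Finset (Fin d)} {r : Fin d → ℕ} (p : ℝ≥0∞) (a b : Fin d → ℝ)
    (f : (Fin d → ℝ) → ℝ) {g : (Fin d → ℝ) → ℝ} (hg : g ∈ polyClass S r) :
    partialError S r p a b f ≤ eLpNorm (fun x => f x - g x) p (volume.restrict (Set.Icc a b)) :=
  iInf_le (fun g : polyClass S r => eLpNorm (fun x => f x - (g : (Fin d → ℝ) → ℝ) x) p
    (volume.restrict (Set.Icc a b))) ⟨g, hg⟩

theorem zero_mem_polyClass (S : Finset (Fin d)) (r : Fin d → ℕ) :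
    (fun _ => 0 : (Fin d → ℝ) → ℝ) ∈ polyClass S r := by
  refine ⟨measurable_const, fun i _ x => ⟨0, ?_, fun s => by simp⟩⟩
  rw [Polynomial.degree_zero]
  exact WithBot.bot_lt_coe _

theorem le_mul_iInf_add {ι : Type*} {F : ι → ℝ≥0∞} {c e X : ℝ≥0∞} (hc0 : c ≠ 0) (hc : c ≠ ∞)
    (h : ∀ j, X ≤ c * F j + e) : X ≤ c * iInf F + e := by
  rw [ENNReal.mul_iInf_of_ne hc0 hc, ENNReal.iInf_add]
  exact le_iInf h

/-- For φ in the larger class, g - φ has the same modulus in coordinate i as g, and adding its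
interpolant to φ stays in the class. With ε = 1/2 every competitor is thus improved to half its
error plus a multiple of the modulus. -/
theorem exists_partialError_insert_le_of_mem {d : ℕ} {r : Fin d → ℕ} {i : Fin d} (hr : 0 < r i)
    {p : ℝ≥0∞} (hp : p ≠ 0) :
    ∃ C : ℝ≥0∞, C ≠ ∞ ∧ ∀ (S : Finset (Fin d)) (a b : Fin d → ℝ) (g : (Fin d → ℝ) → ℝ),
      a i < b i → g ∈ polyClass S r → eLpNorm g p (volume.restrict (Set.Icc a b)) ≠ ∞ →
      partialError (insert i S) r p a b g ≤ C * coordModulus i (r i) p a b g := by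
  have hhalf : (2 : ℝ≥0∞)⁻¹ ≠ 0 := by simp
  obtain ⟨C, hC, h⟩ := exists_eLpNorm_sub_interp_le hr hp hhalf
  refine ⟨2 * C, ENNReal.mul_ne_top ENNReal.ofNat_ne_top hC, fun S a b g hab hg hgn => ?_⟩
  set E := partialError (insert i S) r p a b g with hE
  have hEtop : E ≠ ∞ := by
    refine ne_top_of_le_ne_top hgn ((partialError_le p a b g (zero_mem_polyClass _ r)).trans ?_)
    simp
  have hstep : E ≤ 2⁻¹ * E + C * coordModulus i (r i) p a b g := by
    refine le_mul_iInf_add hhalf (by simp) fun ⟨φ, hφ⟩ => ?_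
    have hψ : (fun x => g x - φ x) ∈ polyClass S r :=
      ⟨hg.1.sub hφ.1, fun k hk => (hg.2 k hk).sub (hφ.2 k (Finset.mem_insert_of_mem hk))⟩
    obtain ⟨y, v, hyv⟩ := h i a b (fun x => g x - φ x) (coordModulus i (r i) p a b g) hab hψ.1
      fun s hs => by
        rw [← coordModulus_sub_of_isPolyIn (hφ.2 i (Finset.mem_insert_self i S))]
        exact le_coordModulus _ _ _ hs
    refine le_trans ?_ hyv
    have hmem : (fun x => φ x + interp i (r i) y v (fun x => g x - φ x) x) ∈
        polyClass (insert i S) r := by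
      refine ⟨hφ.1.add (Measurable.interp hψ.1 i (r i) y v), fun k hk => (hφ.2 k hk).add ?_⟩
      by_cases hki : k = i
      · subst hki
        exact isPolyIn_interp _ _ _ _ _
      · exact (hψ.2 k ((Finset.mem_insert.1 hk).resolve_left hki)).interp_of_ne hki _ _ _
    refine (partialError_le p a b g hmem).trans (le_of_eq ?_)
    congr 1
    funext x
    ring
  -- E ≤ E / 2 + CM is doubled and E is cancelled, which requires E to be finite; this is where g ∈
  -- L_p enters.
  have h2 : E + E ≤ E + 2 * C * coordModulus i (r i) p a b g := by
    calc E + E = 2 * E := (two_mul E).symm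
      _ ≤ 2 * (2⁻¹ * E + C * coordModulus i (r i) p a b g) := by gcongr
      _ = _ := by
        rw [mul_add, ← mul_assoc, ENNReal.mul_inv_cancel two_ne_zero ENNReal.ofNat_ne_top, one_mul,
          mul_assoc]
  exact (ENNReal.add_le_add_iff_left hEtop).1 h2

/-- For any g polynomial in the coordinates of S, the preceding lemma applies to g, and the modulus
of g exceeds that of f by at most a multiple of ‖f - g‖, up to constants. The infimum over g then
gives the partial error of f. -/
theorem exists_partialError_insert_le {d : ℕ} {r : Fin d → ℕ} {i : Fin d} (hr : 0 < r i)
    {p : ℝ≥0∞} (hp : p ≠ 0) :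
    ∃ C : ℝ≥0∞, C ≠ ∞ ∧ ∀ (S : Finset (Fin d)) (a b : Fin d → ℝ) (f : (Fin d → ℝ) → ℝ),
      a i < b i → Measurable f → eLpNorm f p (volume.restrict (Set.Icc a b)) ≠ ∞ →
      partialError (insert i S) r p a b f ≤
        C * (partialError S r p a b f + coordModulus i (r i) p a b f) := by
  obtain ⟨C, hC, h⟩ := exists_partialError_insert_le_of_mem hr hp
  obtain ⟨K, hK, h'⟩ := exists_coordModulus_le (r i) p
  set Λ := ENNReal.LpAddConst p
  have hΛ : Λ ≠ ∞ := (ENNReal.LpAddConst_lt_top p).ne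
  have hΛ1 : 1 ≤ Λ := one_le_LpAddConst p
  have hΛ0 : Λ ≠ 0 := (one_pos.trans_le hΛ1).ne'
  have hCK : C * K ≠ ∞ := ENNReal.mul_ne_top hC hK
  have hD : Λ * (1 + C * K) ≠ ∞ :=
    ENNReal.mul_ne_top hΛ (ENNReal.add_ne_top.2 ⟨ENNReal.one_ne_top, hCK⟩)
  have hD0 : Λ * (1 + C * K) ≠ 0 := mul_ne_zero hΛ0 (by simp)
  refine ⟨Λ * (1 + C * K), hD, fun S a b f hab hf hfn => ?_⟩
  rw [mul_add]
  refine le_mul_iInf_add hD0 hD fun ⟨g, hg⟩ => ?_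
  simp only
  set R := eLpNorm (fun x => f x - g x) p (volume.restrict (Set.Icc a b)) with hR
  -- A competitor at infinite distance gives a trivial bound; any other lies in L_p, as the
  -- absorption step demands.
  by_cases hRtop : R = ∞
  · rw [hRtop, ENNReal.mul_top hD0]
    exact le_top.trans le_self_add
  have hgn : eLpNorm g p (volume.restrict (Set.Icc a b)) ≠ ∞ := by
    have h1 : g = f - fun x => f x - g x := by funext x; simp
    rw [h1]
    exact ne_top_of_le_ne_top (ENNReal.mul_ne_top hΛ (ENNReal.add_ne_top.2 ⟨hfn, hRtop⟩))
      (eLpNorm_sub_le' hf.aestronglyMeasurable (hf.sub hg.1).aestronglyMeasurable p)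
  have h1 : partialError (insert i S) r p a b f ≤
      Λ * partialError (insert i S) r p a b g + Λ * R := by
    refine le_mul_iInf_add hΛ0 hΛ fun ⟨φ, hφ⟩ => (partialError_le p a b f hφ).trans ?_
    rw [← mul_add, add_comm]
    refine le_trans (le_of_eq ?_) (eLpNorm_add_le' (hf.sub hg.1).aestronglyMeasurable
      (hg.1.sub hφ.1).aestronglyMeasurable p)
    congr 1
    funext x
    simp
  calc partialError (insert i S) r p a b f
      ≤ Λ * partialError (insert i S) r p a b g + Λ * R := h1
    _ ≤ Λ * (C * (K * (coordModulus i (r i) p a b f + R))) + Λ * R := by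
        gcongr
        exact (h S a b g hab hg hgn).trans (by gcongr; exact h' i a b f g hf hg.1)
    _ ≤ Λ * (C * (K * (coordModulus i (r i) p a b f + R))) + Λ * R +
          Λ * coordModulus i (r i) p a b f := le_self_add
    _ = _ := by ring

theorem exists_partialError_le {d : ℕ} {r : Fin d → ℕ} (hr : ∀ i, 0 < r i) {p : ℝ≥0∞} (hp : p ≠ 0)
    (S : Finset (Fin d)) :
    ∃ C : ℝ≥0∞, C ≠ ∞ ∧ ∀ (a b : Fin d → ℝ) (f : (Fin d → ℝ) → ℝ),
      (∀ i, a i < b i) → Measurable f → eLpNorm f p (volume.restrict (Set.Icc a b)) ≠ ∞ →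
      partialError S r p a b f ≤ C * ∑ i ∈ S, coordModulus i (r i) p a b f := by
  induction S using Finset.induction_on with
  | empty =>
    refine ⟨0, ENNReal.zero_ne_top, fun a b f _ hf _ => ?_⟩
    refine (partialError_le (g := f) p a b f ⟨hf, by simp⟩).trans ?_
    simp
  | insert i S hi ih =>
    obtain ⟨C, hC, h⟩ := ih
    obtain ⟨C', hC', h'⟩ := exists_partialError_insert_le (hr i) hp
    refine ⟨C' * (C + 1), ENNReal.mul_ne_top hC' (ENNReal.add_ne_top.2 ⟨hC, ENNReal.one_ne_top⟩),
      fun a b f hab hf hfn => ?_⟩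
    rw [Finset.sum_insert hi]
    refine (h' S a b f (hab i) hf hfn).trans ?_
    rw [mul_assoc]
    gcongr
    refine (add_le_add (h a b f hab hf hfn) le_rfl).trans ?_
    set s := ∑ i ∈ S, coordModulus i (r i) p a b f
    calc C * s + coordModulus i (r i) p a b f
        ≤ C * s + coordModulus i (r i) p a b f + (C * coordModulus i (r i) p a b f + s) :=
          le_self_add
      _ = _ := by ring

theorem bestApproxError_le_partialError {d : ℕ} {r : Fin d → ℕ} (hr : ∀ i, 0 < r i) (p : ℝ≥0∞)
    (a b : Fin d → ℝ) (f : (Fin d → ℝ) → ℝ) :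
    bestApproxError r f p a b ≤ partialError Finset.univ r p a b f := by
  refine le_iInf fun ⟨g, hg⟩ => ?_
  obtain ⟨P, hP, -, hP'⟩ := exists_mvPolynomial_of_isPolyIn Finset.univ hg.2 0
  have hPr : P ∈ polySet r := fun i => by
    have h1 := hP i (Finset.mem_univ i)
    have h2 := hr i
    omega
  refine (iInf₂_le P hPr).trans (le_of_eq ?_)
  congr 1
  funext x
  rw [← hP' x (by simp)]

theorem coordDiff_zero_order (i : Fin d) (s : ℝ) (f : (Fin d → ℝ) → ℝ) :
    coordDiff i 0 s f = f := by
  funext x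
  simp [coordDiff]

theorem foldr_coordDiff_single (r : Fin d → ℕ) (i : Fin d) (h : Fin d → ℝ) (f : (Fin d → ℝ) → ℝ)
    {l : List (Fin d)} (hl : l.Nodup) :
    l.foldr (fun k g => coordDiff k (restrictIndex r {i} k) (h k) g) f =
      if i ∈ l then coordDiff i (r i) (h i) f else f := by
  induction l with
  | nil => simp
  | cons k l ih =>
    rw [List.nodup_cons] at hl
    rw [List.foldr_cons, ih hl.2]
    by_cases hk : k = i
    · subst hk
      simp [hl.1, restrictIndex]
    · have hk' : restrictIndex r {i} k = 0 := by simp [restrictIndex, hk]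
      rw [hk', coordDiff_zero_order]
      simp [List.mem_cons, Ne.symm hk]

theorem mixedDiff_single (r : Fin d → ℕ) (i : Fin d) (h : Fin d → ℝ) (f : (Fin d → ℝ) → ℝ) :
    mixedDiff (restrictIndex r {i}) h f = coordDiff i (r i) (h i) f := by
  rw [mixedDiff, foldr_coordDiff_single r i h f (List.nodup_finRange d),
    if_pos (List.mem_finRange i)]

/-- Steps supported on the single coordinate i are admissible in the mixed modulus, and the
remaining differences have order 0. -/
theorem coordModulus_le_mixedModulus (r : Fin d → ℕ) (i : Fin d) (p : ℝ≥0∞) {a b : Fin d → ℝ}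
    (hab : ∀ i, a i ≤ b i) (f : (Fin d → ℝ) → ℝ) :
    coordModulus i (r i) p a b f ≤
      mixedModulus (restrictIndex r {i}) f (fun i => b i - a i) p a b := by
  refine iSup₂_le fun s hs => ?_
  have hh : ∀ k, |(Pi.single i s : Fin d → ℝ) k| ≤ b k - a k := by
    intro k
    by_cases hk : k = i
    · subst hk; simpa using hs
    · simpa [hk] using hab k
  refine le_trans (le_of_eq ?_) (le_iSup₂ (f := fun (h : Fin d → ℝ)
    (_ : ∀ k, |h k| ≤ b k - a k) => eLpNorm (mixedDiff (restrictIndex r {i}) h f) p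
      (volume.restrict (shiftBox a b (fun k => (restrictIndex r {i} k : ℝ) * h k)))) _ hh)
  rw [mixedDiff_single, Pi.single_eq_same, cutDiff,
    eLpNorm_indicator_eq_eLpNorm_restrict (measurableSet_diffDomain _ _ _ _ _)]
  congr 2
  ext x
  constructor
  · rintro ⟨h1, h2⟩
    refine ⟨h1, fun k => ⟨apply_mem_Icc h1 k, ?_⟩⟩
    by_cases hk : k = i
    · subst hk; simpa [restrictIndex] using h2
    · simpa [hk] using apply_mem_Icc h1 k
  · rintro ⟨h1, h2⟩
    exact ⟨h1, by simpa [restrictIndex] using (h2 i).2⟩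

theorem sum_coordModulus_le (r : Fin d → ℕ) (p : ℝ≥0∞) {a b : Fin d → ℝ}
    (hab : ∀ i, a i ≤ b i) (f : (Fin d → ℝ) → ℝ) :
    ∑ i, coordModulus i (r i) p a b f ≤ totalMixedModulus r f (fun i => b i - a i) p a b := by
  calc ∑ i, coordModulus i (r i) p a b f
      ≤ ∑ i, mixedModulus (restrictIndex r {i}) f (fun i => b i - a i) p a b :=
        Finset.sum_le_sum fun i _ => coordModulus_le_mixedModulus r i p hab f
    _ = ∑ e ∈ Finset.univ.image fun i : Fin d => ({i} : Finset (Fin d)),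
          mixedModulus (restrictIndex r e) f (fun i => b i - a i) p a b := by
        rw [Finset.sum_image fun i _ j _ hij => Finset.singleton_injective hij]
    _ ≤ _ := by
        refine Finset.sum_le_sum_of_subset fun e he => ?_
        obtain ⟨i, -, rfl⟩ := Finset.mem_image.1 he
        simp

theorem exists_bestApproxError_le {d : ℕ} {r : Fin d → ℕ} (hr : ∀ i, 0 < r i) {p : ℝ≥0∞}
    (hp : p ≠ 0) :
    ∃ C : ℝ≥0∞, C ≠ ∞ ∧ ∀ (a b : Fin d → ℝ) (f : (Fin d → ℝ) → ℝ),
      (∀ i, a i ≤ b i) → Measurable f → eLpNorm f p (volume.restrict (Set.Icc a b)) ≠ ∞ →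
      bestApproxError r f p a b ≤ C * totalMixedModulus r f (fun i => b i - a i) p a b := by
  obtain ⟨C, hC, h⟩ := exists_partialError_le hr hp Finset.univ
  refine ⟨C, hC, fun a b f hab hf hfn => ?_⟩
  by_cases hab' : ∀ i, a i < b i
  · refine (bestApproxError_le_partialError hr p a b f).trans ((h a b f hab' hf hfn).trans ?_)
    gcongr
    exact sum_coordModulus_le r p hab f
  -- A degenerate box is a null set, so every error vanishes and the zero polynomial suffices.
  · push Not at hab'
    obtain ⟨i, hi⟩ := hab'
    have hvol : (volume : Measure (Fin d → ℝ)) (Set.Icc a b) = 0 := by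
      rw [Real.volume_Icc_pi]
      refine Finset.prod_eq_zero (Finset.mem_univ i) ?_
      rw [ENNReal.ofReal_eq_zero]
      linarith
    have h0 : (0 : MvPolynomial (Fin d) ℝ) ∈ polySet r := fun k => by
      rw [MvPolynomial.degreeOf_zero]; exact hr k
    refine (iInf₂_le _ h0).trans ?_
    rw [Measure.restrict_eq_zero.2 hvol, eLpNorm_measure_zero]
    exact zero_le

end UpperBound

/-! ### The lower estimate: differences are bounded and annihilate polynomials -/

section LowerBound

variable {d : ℕ}

/-- The composition of the coordinate differences over the coordinates of a list. -/
def listDiff (l : List (Fin d)) (k : Fin d → ℕ) (h : Fin d → ℝ) (f : (Fin d → ℝ) → ℝ) :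
    (Fin d → ℝ) → ℝ :=
  l.foldr (fun i g => coordDiff i (k i) (h i) g) f

/-- The points of the box that stay in the box after the shifts in the coordinates of a list. -/
def listDomain (l : List (Fin d)) (k : Fin d → ℕ) (h a b : Fin d → ℝ) : Set (Fin d → ℝ) :=
  {x | x ∈ Set.Icc a b ∧ ∀ i ∈ l, x i + k i * h i ∈ Set.Icc (a i) (b i)}

theorem listDomain_nil (k : Fin d → ℕ) (h a b : Fin d → ℝ) :
    listDomain [] k h a b = Set.Icc a b := by
  ext x
  simp [listDomain]

theorem listDomain_cons (i : Fin d) (l : List (Fin d)) (k : Fin d → ℕ) (h a b : Fin d → ℝ) :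
    listDomain (i :: l) k h a b = listDomain l k h a b ∩ diffDomain i (k i) (h i) a b := by
  ext x
  simp only [listDomain, diffDomain, List.mem_cons, forall_eq_or_imp, Set.mem_ofPred_eq,
    Set.mem_inter_iff]
  tauto

theorem measurableSet_listDomain (l : List (Fin d)) (k : Fin d → ℕ) (h a b : Fin d → ℝ) :
    MeasurableSet (listDomain l k h a b) := by
  induction l with
  | nil => rw [listDomain_nil]; exact measurableSet_Icc
  | cons i l ih => rw [listDomain_cons]; exact ih.inter (measurableSet_diffDomain i _ _ a b)

theorem shiftBox_eq_listDomain (k : Fin d → ℕ) (h a b : Fin d → ℝ) :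
    shiftBox a b (fun i => (k i : ℝ) * h i) = listDomain (List.finRange d) k h a b := by
  ext x
  simp only [shiftBox, listDomain, List.mem_finRange, true_implies, Set.mem_ofPred_eq]
  exact and_congr_right fun hx => forall_congr' fun i => and_iff_right (apply_mem_Icc hx i)

theorem update_mem_listDomain {i : Fin d} {l : List (Fin d)} (hi : i ∉ l) {k : Fin d → ℕ}
    {h a b x : Fin d → ℝ} (hx : x ∈ listDomain (i :: l) k h a b) {j : ℕ} (hj : j ≤ k i) :
    Function.update x i (x i + j * h i) ∈ listDomain l k h a b := by
  rw [listDomain_cons] at hx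
  refine ⟨update_mem_Icc_of_mem_diffDomain hx.2 hj, fun m hm => ?_⟩
  rw [Function.update_of_ne (ne_of_mem_of_not_mem hm hi)]
  exact hx.1.2 m hm

theorem measurable_listDiff (l : List (Fin d)) (k : Fin d → ℕ) (h : Fin d → ℝ)
    {f : (Fin d → ℝ) → ℝ} (hf : Measurable f) : Measurable (listDiff l k h f) := by
  induction l with
  | nil => exact hf
  | cons i l ih => exact Measurable.coordDiff ih i (k i) (h i)

/-- The differences are peeled off one at a time. Since coordinates do not repeat, shifts in the
outer coordinate leave the domain conditions of the inner ones intact. -/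
theorem exists_eLpNorm_listDiff_le (k : Fin d → ℕ) (p : ℝ≥0∞) {l : List (Fin d)} (hl : l.Nodup) :
    ∃ C : ℝ≥0∞, C ≠ ∞ ∧ ∀ (h a b : Fin d → ℝ) (f : (Fin d → ℝ) → ℝ), Measurable f →
      eLpNorm (listDiff l k h f) p (volume.restrict (listDomain l k h a b)) ≤
        C * eLpNorm f p (volume.restrict (Set.Icc a b)) := by
  induction l with
  | nil =>
    refine ⟨1, ENNReal.one_ne_top, fun h a b f _ => ?_⟩
    rw [listDomain_nil, one_mul]
    exact le_rfl
  | cons i l ih =>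
    rw [List.nodup_cons] at hl
    obtain ⟨C, hC, hbd⟩ := ih hl.2
    refine ⟨ENNReal.ofReal (2 ^ k i) * sumConst p (k i + 1) * C, ENNReal.mul_ne_top
      (ENNReal.mul_ne_top ENNReal.ofReal_ne_top (sumConst_ne_top _ _)) hC, fun h a b f hf => ?_⟩
    refine (eLpNorm_coordDiff_le (measurableSet_listDomain (i :: l) k h a b)
      (measurableSet_listDomain l k h a b) (fun x hx j hj => update_mem_listDomain hl.1 hx hj)
      (measurable_listDiff l k h hf) p).trans ?_
    rw [mul_assoc _ C]
    gcongr
    exact hbd h a b f hf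

theorem coordDiff_ae_eq {A B : Set (Fin d → ℝ)} (hA : MeasurableSet A) (hB : MeasurableSet B)
    {i : Fin d} {k : ℕ} {s : ℝ}
    (hAB : ∀ x ∈ A, ∀ j ≤ k, Function.update x i (x i + j * s) ∈ B) {f g : (Fin d → ℝ) → ℝ}
    (hfg : f =ᵐ[volume.restrict B] g) :
    coordDiff i k s f =ᵐ[volume.restrict A] coordDiff i k s g := by
  have h1 : ∀ᵐ x ∂(volume : Measure (Fin d → ℝ)), ∀ j : ℕ,
      Function.update x i (x i + j * s) ∈ B →
        f (Function.update x i (x i + j * s)) = g (Function.update x i (x i + j * s)) :=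
    ae_all_iff.2 fun j => (measurePreserving_update_add i (j * s)).quasiMeasurePreserving.ae
      ((ae_restrict_iff' hB).1 hfg)
  filter_upwards [ae_restrict_of_ae h1, ae_restrict_mem hA] with x hx hxA
  refine Finset.sum_congr rfl fun j hj => ?_
  rw [hx j (hAB x hxA j (Nat.lt_succ_iff.1 (Finset.mem_range.1 hj)))]

theorem listDiff_ae_eq (k : Fin d → ℕ) (h a b : Fin d → ℝ) {f g : (Fin d → ℝ) → ℝ}
    (hfg : f =ᵐ[volume.restrict (Set.Icc a b)] g) {l : List (Fin d)} (hl : l.Nodup) :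
    listDiff l k h f =ᵐ[volume.restrict (listDomain l k h a b)] listDiff l k h g := by
  induction l with
  | nil => rw [listDomain_nil]; exact hfg
  | cons i l ih =>
    rw [List.nodup_cons] at hl
    exact coordDiff_ae_eq (measurableSet_listDomain (i :: l) k h a b)
      (measurableSet_listDomain l k h a b) (fun x hx j hj => update_mem_listDomain hl.1 hx hj)
      (ih hl.2)

theorem listDiff_sub (l : List (Fin d)) (k : Fin d → ℕ) (h : Fin d → ℝ)
    (f g : (Fin d → ℝ) → ℝ) :
    listDiff l k h (fun x => f x - g x) = fun x => listDiff l k h f x - listDiff l k h g x := by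
  induction l with
  | nil => rfl
  | cons i l ih =>
    change coordDiff i (k i) (h i) (listDiff l k h fun x => f x - g x) = _
    rw [ih, coordDiff_sub]
    rfl

theorem IsPolyIn.listDiff {i : Fin d} {n : ℕ} {g : (Fin d → ℝ) → ℝ} (hg : IsPolyIn i n g)
    {l : List (Fin d)} (hi : i ∉ l) (k : Fin d → ℕ) (h : Fin d → ℝ) :
    IsPolyIn i n (listDiff l k h g) := by
  induction l with
  | nil => exact hg
  | cons m l ih =>
    rw [List.mem_cons, not_or] at hi
    exact (ih hi.2).coordDiff_of_ne hi.1 _ _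

/-- Differences applied before the one in coordinate i keep g a polynomial in `x i`; the i-th gives
zero, and later ones preserve zero. -/
theorem listDiff_eq_zero {i : Fin d} {k : Fin d → ℕ} {g : (Fin d → ℝ) → ℝ}
    (hg : IsPolyIn i (k i) g) {l : List (Fin d)} (hl : l.Nodup) (hi : i ∈ l) (h : Fin d → ℝ) :
    listDiff l k h g = 0 := by
  induction l with
  | nil => simp at hi
  | cons m l ih =>
    rw [List.nodup_cons] at hl
    change coordDiff m (k m) (h m) (listDiff l k h g) = 0
    by_cases hm : i = m
    · subst hm
      exact coordDiff_eq_zero_of_isPolyIn (hg.listDiff hl.1 k h) _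
    · rw [ih hl.2 ((List.mem_cons.1 hi).resolve_left hm)]
      funext x
      simp [coordDiff]

theorem exists_mixedModulus_le (r : Fin d → ℕ) (p : ℝ≥0∞) {e : Finset (Fin d)}
    (he : e.Nonempty) :
    ∃ C : ℝ≥0∞, C ≠ ∞ ∧ ∀ (a b t : Fin d → ℝ) (f : (Fin d → ℝ) → ℝ), Measurable f →
      mixedModulus (restrictIndex r e) f t p a b ≤ C * bestApproxError r f p a b := by
  obtain ⟨i, hi⟩ := he
  have hl := List.nodup_finRange d
  obtain ⟨C, hC, hbd⟩ := exists_eLpNorm_listDiff_le (restrictIndex r e) p hl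
  -- The added 1 makes the constant nonzero, so that it can be moved inside the infimum over
  -- polynomials.
  refine ⟨C + 1, ENNReal.add_ne_top.2 ⟨hC, ENNReal.one_ne_top⟩, fun a b t f hf => ?_⟩
  refine iSup₂_le fun h _ => ?_
  rw [shiftBox_eq_listDomain, bestApproxError, iInf_subtype', ← add_zero ((C + 1) * _)]
  refine le_mul_iInf_add (by simp) (ENNReal.add_ne_top.2 ⟨hC, ENNReal.one_ne_top⟩)
    fun ⟨P, hP⟩ => ?_
  have hPi : IsPolyIn i (restrictIndex r e i) (fun x => MvPolynomial.eval x P) := by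
    rw [restrictIndex, if_pos hi]
    exact isPolyIn_eval hP i
  have hPm : Measurable fun x : Fin d → ℝ => MvPolynomial.eval x P :=
    (MvPolynomial.continuous_eval P).measurable
  have h1 : mixedDiff (restrictIndex r e) h f = listDiff (List.finRange d) (restrictIndex r e) h
      (fun x => f x - MvPolynomial.eval x P) := by
    rw [listDiff_sub, listDiff_eq_zero hPi hl (List.mem_finRange i)]
    simp only [Pi.zero_apply, sub_zero]
    rfl
  rw [h1, add_zero]
  exact (hbd h a b _ (hf.sub hPm)).trans (mul_le_mul_left le_self_add _)

theorem exists_totalMixedModulus_le (r : Fin d → ℕ) (p : ℝ≥0∞) :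
    ∃ C : ℝ≥0∞, C ≠ ∞ ∧ ∀ (a b t : Fin d → ℝ) (f : (Fin d → ℝ) → ℝ), Measurable f →
      totalMixedModulus r f t p a b ≤ C * bestApproxError r f p a b := by
  have h : ∀ e : Finset (Fin d), ∃ C : ℝ≥0∞, C ≠ ∞ ∧ (e.Nonempty →
      ∀ (a b t : Fin d → ℝ) (f : (Fin d → ℝ) → ℝ), Measurable f →
        mixedModulus (restrictIndex r e) f t p a b ≤ C * bestApproxError r f p a b) := by
    intro e
    by_cases he : e.Nonempty
    · obtain ⟨C, hC, h⟩ := exists_mixedModulus_le r p he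
      exact ⟨C, hC, fun _ => h⟩
    · exact ⟨0, ENNReal.zero_ne_top, fun he' => absurd he' he⟩
  choose C hC hbd using h
  refine ⟨∑ e : Finset (Fin d) with e.Nonempty, C e, ENNReal.sum_ne_top.2 fun e _ => hC e,
    fun a b t f hf => ?_⟩
  rw [totalMixedModulus, Finset.sum_mul]
  exact Finset.sum_le_sum fun e he => hbd e (Finset.mem_filter.1 he).2 a b t f hf

/-- A difference involves finitely many translates, and translations preserve null sets. This
permits replacing `f` by a measurable representative. -/
theorem totalMixedModulus_congr_ae (r : Fin d → ℕ) (t : Fin d → ℝ) (p : ℝ≥0∞) {a b : Fin d → ℝ}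
    {f g : (Fin d → ℝ) → ℝ} (hfg : f =ᵐ[volume.restrict (Set.Icc a b)] g) :
    totalMixedModulus r f t p a b = totalMixedModulus r g t p a b := by
  refine Finset.sum_congr rfl fun e _ => iSup_congr fun h => iSup_congr fun _ => ?_
  rw [shiftBox_eq_listDomain]
  exact eLpNorm_congr_ae (listDiff_ae_eq _ h a b hfg (List.nodup_finRange d))

theorem bestApproxError_congr_ae (r : Fin d → ℕ) (p : ℝ≥0∞) {a b : Fin d → ℝ}
    {f g : (Fin d → ℝ) → ℝ} (hfg : f =ᵐ[volume.restrict (Set.Icc a b)] g) :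
    bestApproxError r f p a b = bestApproxError r g p a b :=
  iInf_congr fun P => iInf_congr fun _ => eLpNorm_congr_ae (by
    filter_upwards [hfg] with x hx
    rw [hx])

end LowerBound

end MixedWhitney

/-! ### The two-sided estimate -/

theorem theorem1 (d : ℕ) (r : Fin d → ℕ) (hr : ∀ i, 0 < r i) (p : ℝ≥0∞) (hp : 0 < p) :
    ∃ C C' : ℝ≥0, 0 < C ∧ 0 < C' ∧
      ∀ a b : Fin d → ℝ, (∀ i, a i ≤ b i) →
        ∀ f : (Fin d → ℝ) → ℝ, MemLp f p (volume.restrict (Set.Icc a b)) →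
          (C' : ℝ≥0∞) * MixedWhitney.totalMixedModulus r f (fun i => b i - a i) p a b
              ≤ MixedWhitney.bestApproxError r f p a b ∧
            MixedWhitney.bestApproxError r f p a b
              ≤ (C : ℝ≥0∞) * MixedWhitney.totalMixedModulus r f (fun i => b i - a i) p a b := by
  obtain ⟨C, hC, hupper⟩ := MixedWhitney.exists_bestApproxError_le hr hp.ne'
  obtain ⟨K, hK, hlower⟩ := MixedWhitney.exists_totalMixedModulus_le r p
  lift C to ℝ≥0 using hC
  lift K to ℝ≥0 using hK
  -- Adding 1 ensures that both constants are positive.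
  refine ⟨C + 1, (K + 1)⁻¹, by positivity, by positivity, fun a b hab f hf => ?_⟩
  have hfg := hf.1.ae_eq_mk
  have hgm : Measurable (hf.1.mk f) := hf.1.stronglyMeasurable_mk.measurable
  rw [MixedWhitney.totalMixedModulus_congr_ae r _ p hfg,
    MixedWhitney.bestApproxError_congr_ae r p hfg]
  constructor
  · rw [ENNReal.coe_inv (by positivity), mul_comm, ← div_eq_mul_inv]
    refine ENNReal.div_le_of_le_mul' ((hlower a b _ _ hgm).trans ?_)
    gcongr
    exact_mod_cast le_self_add
  · refine (hupper a b _ hab hgm ?_).trans ?_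
    · rw [← eLpNorm_congr_ae hfg]
      exact hf.2.ne
    · gcongr
      exact_mod_cast le_self_add
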